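/- Let $d\ge 1$ and let $\mathcal X=[0,1]^d$ carry a probability measure $P$ with Lebesgue density $p$ satisfying $0<p_{\min}:=\inf_{\mathcal X}p\le p_{\max}:=\sup_{\mathcal X}p<\infty$. Let $\varphi:[0,1]\to\mathbb R$ be continuous and such that $k(x,y)=\varphi\big(d^{-1}\|x-y\|_2^2\big)$ is a (symmetric) positive semidefinite kernel on $\mathcal X$. Let $\mathcal H_k$ be its reproducing kernel Hilbert space, $k_x=k(\cdot,x)$, and let $L_k:\mathcal H_k\to\mathcal H_k$ be the integral operator $(L_kw)(y)=\int_{\mathcal X}w(x)k(x,y)p(x)\,dx$. For $\lambda>0$ define the maximal marginal degrees of freedom $$\mathcal N_\infty(\lambda)=\sup_{x\in\mathcal X}\big\langle k_x,(\lambda+L_k)^{-1}k_x\big\rangle_k .$$ Put $\tilde\varphi(t)=\varphi\big(\tfrac{t+1}{2}\big)$ for $t\in[-1,1]$. (A) Let $s>3d$ be an integer such that $\tilde\varphi,\tilde\varphi',\dots,\tilde\varphi^{(s-1)}$ are absolutely continuous on $[-1,1]$, $\tilde\varphi^{(s)}$ is (almost everywhere equal to a function) of bounded variation, and $V_s=\int_{-1}^1|\tilde\varphi^{(s+1)}(t)|(1-t^2)^{-1/4}\,dt<\infty$,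 where $\tilde\varphi^{(s+1)}$ denotes the almost everywhere derivative of $\tilde\varphi^{(s)}$. Then there are constants $C_s>0$ and $\lambda_0>0$, depending only on $p$, $d$, $\varphi$ and $s$, such that for all $0<\lambda<\lambda_0$ $$\mathcal N_\infty(\lambda)\le C_s\,\lambda^{-\frac{2d}{s-d-1/2}} .$$ (B) Suppose that for some $\rho>1$ the function $\tilde\varphi$ extends to a function analytic in the open region bounded by the Bernstein ellipse $\mathcal E_\rho$ (foci $\pm1$, sum of the semi-axes equal to $\rho$). Then there are constants $C_\rho>0$ and $\lambda_0>0$, depending only on $p$, $d$ and $\varphi$, such that for all $0<\lambda<\lambda_0$ $$\mathcal N_\infty(\lambda)\le C_\rho\,\ln(\lambda^{-1})^{2d} .$$ -/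

import Mathlib

open MeasureTheory Set

noncomputable section

section KernelSpace

variable {X : Type*} (k : X → X → ℝ)

/-- The real kernel `k` as a matrix of (one-dimensional) operators, the form in which Mathlib
builds reproducing kernel Hilbert spaces. -/
def kernelOp : Matrix X X (ℝ →L[ℝ] ℝ) :=
  Matrix.of fun x y => k x y • ContinuousLinearMap.id ℝ ℝ

theorem kernelOp_posSemidef (hk : (Matrix.of k).PosSemidef) : (kernelOp k).PosSemidef := by
  have e := (RKHS.posSemidef_tfae (K := kernelOp k)).out 0 2 rfl rfl
  refine e.mpr ⟨?_, ?_⟩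
  · ext x y
    have h := hk.1.apply x y
    simp only [Matrix.of_apply, star_trivial] at h
    have h0 : star (ContinuousLinearMap.id ℝ ℝ) = ContinuousLinearMap.id ℝ ℝ := star_one _
    simp [kernelOp, h, h0]
  · intro v
    have h := hk.2 v
    simp only [Matrix.of_apply, star_trivial] at h
    simp only [kernelOp, Matrix.of_apply, RCLike.re_to_real]
    refine h.trans_eq (Finsupp.sum_congr fun x _ => Finsupp.sum_congr fun y _ => ?_)
    have h' := hk.1.apply x y
    simp only [Matrix.of_apply, star_trivial] at h'
    simp [h']
    ring

instance kernelOp_fact [h : Fact (Matrix.of k).PosSemidef] : Fact (kernelOp k).PosSemidef :=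
  ⟨kernelOp_posSemidef k h.out⟩

/-- The reproducing kernel Hilbert space `H_k` of the positive semidefinite kernel `k`: the
completion of the span of the functions `k(·, x)`. -/
abbrev KernelSpace [Fact (Matrix.of k).PosSemidef] : Type _ := RKHS.OfKernel (kernelOp k)

variable [Fact (Matrix.of k).PosSemidef]

/-- The point evaluation function `k_x = k(·, x)`, as an element of `H_k`. -/
def pointEval (x : X) : KernelSpace k := RKHS.kerFun (KernelSpace k) x 1

theorem pointEval_apply (x y : X) : pointEval k x y = k y x := by
  rw [pointEval, RKHS.kerFun_apply, RKHS.OfKernel.kernel_ofKernel]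
  simp [kernelOp]

theorem inner_pointEval (x : X) (f : KernelSpace k) : inner ℝ (pointEval k x) f = f x := by
  simp [pointEval]

theorem abs_apply_le (x : X) (f : KernelSpace k) : |f x| ≤ ‖f‖ * ‖pointEval k x‖ := by
  rw [← inner_pointEval, mul_comm]
  exact abs_real_inner_le_norm _ _

variable {k} [TopologicalSpace X]

theorem continuous_pointEval (hc : Continuous fun q : X × X => k q.1 q.2) :
    Continuous (pointEval k) := by
  have hi : ∀ x y, inner ℝ (pointEval k x) (pointEval k y) = k x y := fun x y => by
    rw [inner_pointEval, pointEval_apply]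
  have key : ∀ x y, ‖pointEval k y - pointEval k x‖ = √(k y y - 2 * k y x + k x x) := by
    intro x y
    rw [← hi y y, ← hi y x, ← hi x x, real_inner_self_eq_norm_sq, real_inner_self_eq_norm_sq,
      ← norm_sub_sq_real, Real.sqrt_sq (norm_nonneg _)]
  rw [continuous_iff_continuousAt]
  intro x
  rw [ContinuousAt, tendsto_iff_norm_sub_tendsto_zero]
  simp_rw [key]
  have h1 : Continuous fun y => k y y := hc.comp (continuous_id.prodMk continuous_id)
  have h2 : Continuous fun y => k y x := hc.comp (continuous_id.prodMk continuous_const)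
  have h3 : Continuous fun y => √(k y y - 2 * k y x + k x x) := by fun_prop
  convert! h3.tendsto x using 2
  rw [show k x x - 2 * k x x + k x x = 0 by ring, Real.sqrt_zero]

variable [CompactSpace X] [T2Space X] [MeasurableSpace X] [BorelSpace X]

theorem integrable_smul_pointEval (hc : Continuous fun q : X × X => k q.1 q.2)
    (P : Measure X) [IsFiniteMeasure P] (f : KernelSpace k) :
    Integrable (fun z => f z • pointEval k z) P := by
  have h1 := continuous_pointEval hc
  have h2 : Continuous fun z => f z := by
    simp_rw [← inner_pointEval]
    fun_prop
  rw [← integrableOn_univ]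
  exact (h2.smul h1).continuousOn.integrableOn_compact isCompact_univ

/-- The integral operator `L_k` on `H_k`, i.e. `(L_k f)(y) = ∫ f(z) k(y, z) dP(z)`
(see `intOp_apply`), for a continuous kernel on a compact space. -/
def intOp (hc : Continuous fun q : X × X => k q.1 q.2) (P : Measure X) [IsFiniteMeasure P] :
    KernelSpace k →L[ℝ] KernelSpace k :=
  LinearMap.mkContinuous
    { toFun := fun f => ∫ z, f z • pointEval k z ∂P
      map_add' := by
        intro f g
        rw [← integral_add (integrable_smul_pointEval hc P f) (integrable_smul_pointEval hc P g)]
        simp [add_smul]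
      map_smul' := by
        intro c f
        rw [RingHom.id_apply, ← integral_smul]
        simp [mul_smul] }
    (∫ z, ‖pointEval k z‖ ^ 2 ∂P) (by
      intro f
      refine (norm_integral_le_integral_norm _).trans ?_
      rw [← integral_mul_const]
      refine integral_mono (integrable_smul_pointEval hc P f).norm ?_ ?_
      · rw [← integrableOn_univ]
        exact (((continuous_pointEval hc).norm.pow 2).mul_const _).continuousOn.integrableOn_compact
          isCompact_univ
      · intro z
        have := abs_apply_le k z f
        simp only [norm_smul, Real.norm_eq_abs]
        nlinarith [norm_nonneg (pointEval k z)])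

theorem intOp_apply (hc : Continuous fun q : X × X => k q.1 q.2) (P : Measure X)
    [IsFiniteMeasure P] (f : KernelSpace k) (y : X) :
    intOp hc P f y = ∫ z, f z * k y z ∂P := by
  have h : intOp hc P f = ∫ z, f z • pointEval k z ∂P := rfl
  rw [← inner_pointEval, h, ← integral_inner (integrable_smul_pointEval hc P f)]
  simp [inner_smul_right, inner_pointEval, pointEval_apply]

theorem isUnit_add_intOp (hc : Continuous fun q : X × X => k q.1 q.2) (P : Measure X)
    [IsFiniteMeasure P] {l : ℝ} (hl : 0 < l) :
    IsUnit (l • (1 : KernelSpace k →L[ℝ] KernelSpace k) + intOp hc P) := by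
  refine ContinuousLinearMap.isUnit_of_forall_le_norm_inner_map _ (c := ⟨l, hl.le⟩) hl
    fun f => ?_
  have h : intOp hc P f = ∫ z, f z • pointEval k z ∂P := rfl
  have h2 : 0 ≤ inner ℝ (intOp hc P f) f := by
    rw [real_inner_comm, h, ← integral_inner (integrable_smul_pointEval hc P f)]
    refine integral_nonneg fun z => ?_
    simp only [inner_smul_right]
    rw [real_inner_comm, inner_pointEval]
    exact mul_self_nonneg _
  have h3 : inner ℝ ((l • (1 : KernelSpace k →L[ℝ] KernelSpace k) + intOp hc P) f) f
      = l * ‖f‖ ^ 2 + inner ℝ (intOp hc P f) f := by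
    simp [inner_add_left, inner_smul_left]
  rw [h3, Real.norm_of_nonneg (by positivity)]
  change ‖f‖ ^ 2 * l ≤ _
  linarith

/-- The maximal marginal degrees of freedom
`N_∞(l) = sup_x ⟨k_x, (l + L_k)⁻¹ k_x⟩_k`; for `l > 0` the operator `l + L_k` is invertible by
`isUnit_add_intOp`. The supremum is taken in the extended reals. -/
def maxMarginalDof (hc : Continuous fun q : X × X => k q.1 q.2) (P : Measure X)
    [IsFiniteMeasure P] (l : ℝ) : EReal :=
  ⨆ x : X, ((inner ℝ (pointEval k x)
    (Ring.inverse (l • (1 : KernelSpace k →L[ℝ] KernelSpace k) + intOp hc P)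
      (pointEval k x)) : ℝ) : EReal)

end KernelSpace

section RadialKernel

/-- The unit cube `[0,1]^d` in Euclidean space. -/
def unitCube (d : ℕ) : Set (EuclideanSpace ℝ (Fin d)) := {x | ∀ i, x i ∈ Icc (0 : ℝ) 1}

instance unitCube_compact (d : ℕ) : CompactSpace (unitCube d) := by
  refine isCompact_iff_compactSpace.mp ?_
  have h : IsCompact (Set.pi univ fun _ : Fin d => Icc (0 : ℝ) 1) :=
    isCompact_univ_pi fun _ => isCompact_Icc
  have h2 := h.image (PiLp.continuous_toLp 2 fun _ : Fin d => ℝ)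
  convert! h2 using 1
  ext x
  constructor
  · intro hx
    exact ⟨x.ofLp, fun i _ => hx i, rfl⟩
  · rintro ⟨y, hy, rfl⟩ i
    exact hy i trivial

/-- The design measure on `[0,1]^d` with Lebesgue density `p`. -/
def designMeasure {d : ℕ} (p : unitCube d → ℝ) : Measure (unitCube d) :=
  (Measure.comap Subtype.val volume).withDensity fun z => ENNReal.ofReal (p z)

/-- The radial kernel `k(x, y) = φ(‖x - y‖² / d)` on `[0,1]^d`. -/
def radialKernel (d : ℕ) (φ : ℝ → ℝ) (x y : unitCube d) : ℝ :=
  φ ((d : ℝ)⁻¹ * ‖(x : EuclideanSpace ℝ (Fin d)) - y‖ ^ 2)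

theorem continuous_radialKernel (d : ℕ) {φ : ℝ → ℝ} (hφ : ContinuousOn φ (Icc 0 1)) :
    Continuous fun q : unitCube d × unitCube d => radialKernel d φ q.1 q.2 := by
  refine hφ.comp_continuous (by fun_prop) fun q => ⟨by positivity, ?_⟩
  have h : ‖(q.1 : EuclideanSpace ℝ (Fin d)) - q.2‖ ^ 2 ≤ d := by
    rw [EuclideanSpace.norm_sq_eq]
    refine (Finset.sum_le_card_nsmul _ _ 1 fun i _ => ?_).trans (by simp)
    have h1 := q.1.2 i
    have h2 := q.2.2 i
    simp only [PiLp.sub_apply, Real.norm_eq_abs, sq_abs]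
    nlinarith [h1.1, h1.2, h2.1, h2.2]
  rw [inv_mul_eq_div]
  exact div_le_one_of_le₀ h (by positivity)

/-- The affine transplant `φ̃(t) = φ((t + 1) / 2)` of `φ` from `[0,1]` to `[-1,1]`. -/
def transplant (φ : ℝ → ℝ) (t : ℝ) : ℝ := φ ((t + 1) / 2)

/-- Finite smoothness of order `s` on `[-1,1]`: there are `g 0 = ψ, g 1, …, g s`, each the
almost everywhere derivative of the previous one, with `g 0, …, g (s-1)` absolutely continuous,
`g s` of bounded variation, and `V_s = ∫ |ψ^{(s+1)}(t)| (1 - t²)^{-1/4} dt` finite. -/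
def FiniteSmoothness (s : ℕ) (ψ : ℝ → ℝ) : Prop :=
  ∃ g : ℕ → ℝ → ℝ,
    (∀ t ∈ Icc (-1 : ℝ) 1, g 0 t = ψ t) ∧
    (∀ j < s, AbsolutelyContinuousOnInterval (g j) (-1) 1 ∧
      ∀ᵐ t ∂volume.restrict (Icc (-1 : ℝ) 1), HasDerivAt (g j) (g (j + 1) t) t) ∧
    BoundedVariationOn (g s) (Icc (-1) 1) ∧
    IntegrableOn (fun t => deriv (g s) t * (1 - t ^ 2) ^ (-(1 / 4) : ℝ)) (Icc (-1) 1)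

/-- The open region bounded by the Bernstein ellipse `E_ρ`, that is, the ellipse with foci `±1`
whose semi-axes `(ρ + ρ⁻¹) / 2` and `(ρ - ρ⁻¹) / 2` have sum `ρ`. -/
def bernsteinRegion (ρ : ℝ) : Set ℂ := {z | ‖z - 1‖ + ‖z + 1‖ < ρ + ρ⁻¹}

/-- `ψ : [-1,1] → ℝ` is (the restriction of a function) analytic in the region bounded by the
Bernstein ellipse `E_ρ`. -/
def AnalyticInEllipse (ρ : ℝ) (ψ : ℝ → ℝ) : Prop :=
  ∃ F : ℂ → ℂ, AnalyticOnNhd ℂ F (bernsteinRegion ρ) ∧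
    ∀ t ∈ Icc (-1 : ℝ) 1, F (t : ℂ) = (ψ t : ℂ)

end RadialKernel

end

/-!
Write `ψ(t) = φ((t + 1) / 2)`. The bound compares the kernel with a polynomial one, and is the
product of two one-dimensional facts.

Let `f = (l + L_k)⁻¹ k_x`. Then `⟨k_x, f⟩ = f(x) = ∫ f² dP + l ‖f‖²`, so an inequality
`f(x)² ≤ N (∫ f² dP + l ‖f‖²)` gives `f(x) ≤ N`. Such an inequality comes from a weight `w` on the
cube which reproduces polynomials at `x`: `f(x) = ∫ w f + ⟨v, f⟩` with `v = k_x - ∫ w(z) k_z dz`.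
The first term is handled by Cauchy–Schwarz and `p ≥ pmin`, at the price `∫ w²`. For the second, if
`ψ` is within `ε` of a polynomial of degree `n` and `w` reproduces degree `2 n`, the polynomial part
of the kernel drops out of `‖v‖²`, leaving `‖v‖² ≤ ε (1 + ∫ |w|)² ≤ 4 ε ∫ w²`. Hence `ε ≤ c l`
yields `N_∞(l) ≤ 2 (1 / pmin + 4 c) ∫ w²` (`inner_pointEval_inverse_le`, `maxMarginalDof_le`).

The weight is a tensor product of Legendre reproducing kernels. On `[-1,1]` a Legendre polynomial
is bounded by its endpoint values (Sonin), so `L_j(t)² ≤ (2 j + 1) ∫ L_j²`; therefore evaluation at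
any point on polynomials of degree `m` has a representer of squared norm at most `(m + 1)²`
(`exists_representer`), and `∫ w²` is of order `n^{2d}`.

The approximation error is controlled by a Jackson inequality in `L²(-1,1)`: Legendre's differential
equation and integration by parts show that the projection error in degree `n` is at most
`‖f'‖ / (n + 1)` (`HasAEDeriv.integral_sub_legendreSum_sq_le`). Iterating it with explicit constants
and integrating once more gives a uniform error `2 B / (m + 1)^s` in degree `m + s + 1`, where `B`
bounds the derivative of order `s + 1` in `L²` (`exists_poly_near`). With `s` derivatives available
this is of order `n^{-(s-1)}`, enough for (A) because `s - d - 1/2 ≤ s - 1`. In the analytic case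
Cauchy's estimate bounds the derivative of order `r` by `r! M / δ^r`, and the choice `m = N r` with
`N` large makes the error exponentially small in the degree (`exists_poly_of_analyticInEllipse`),
which gives (B).
-/

open Polynomial

/-! ### Legendre polynomials -/

noncomputable section Legendre

/-- Integration over `[-1,1]`, as a linear functional on real polynomials. -/
def integralPoly : ℝ[X] →ₗ[ℝ] ℝ where
  toFun p := ∫ t in (-1 : ℝ)..1, p.eval t
  map_add' p q := by
    simp only [eval_add]
    exact intervalIntegral.integral_add (p.continuous.intervalIntegrable _ _)
      (q.continuous.intervalIntegrable _ _)
  map_smul' c p := by simp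

theorem integralPoly_apply (p : ℝ[X]) : integralPoly p = ∫ t in (-1 : ℝ)..1, p.eval t := rfl

theorem integralPoly_derivative (p : ℝ[X]) :
    integralPoly (derivative p) = p.eval 1 - p.eval (-1) :=
  intervalIntegral.integral_eq_sub_of_hasDerivAt (fun t _ => p.hasDerivAt t)
    ((derivative p).continuous.intervalIntegrable _ _)

theorem integralPoly_derivative_mul (p q : ℝ[X]) :
    integralPoly (derivative p * q) =
      (p * q).eval 1 - (p * q).eval (-1) - integralPoly (p * derivative q) := by
  rw [← integralPoly_derivative, derivative_mul, map_add]
  ring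

theorem integralPoly_mul_self_nonneg (p : ℝ[X]) : 0 ≤ integralPoly (p * p) := by
  refine intervalIntegral.integral_nonneg (by norm_num) fun t _ => ?_
  rw [eval_mul]
  exact mul_self_nonneg _

theorem integralPoly_mul_self_pos {p : ℝ[X]} (hp : p ≠ 0) : 0 < integralPoly (p * p) := by
  obtain ⟨t, ht, hne⟩ : ∃ t ∈ Icc (-1 : ℝ) 1, p.eval t ≠ 0 := by
    by_contra! h
    exact hp (p.eq_zero_of_infinite_isRoot ((Icc_infinite (by norm_num : (-1 : ℝ) < 1)).mono h))
  refine intervalIntegral.integral_pos (by norm_num) (p * p).continuous.continuousOn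
    (fun s _ => ?_) ⟨t, ht, ?_⟩
  · rw [eval_mul]
    exact mul_self_nonneg _
  · rw [eval_mul]
    exact mul_self_pos.2 hne

/-- The Legendre polynomial of degree `n` in Rodrigues' normalization without constant factor,
`L_n = dⁿ/dtⁿ (t² - 1)ⁿ`. -/
def legendre (n : ℕ) : ℝ[X] := derivative^[n] ((X ^ 2 - 1) ^ n)

theorem monic_sq_sub_one_pow (n : ℕ) : ((X ^ 2 - 1 : ℝ[X]) ^ n).Monic :=
  (monic_X_pow_sub_C (1 : ℝ) two_ne_zero).pow n

theorem natDegree_sq_sub_one_pow (n : ℕ) : ((X ^ 2 - 1 : ℝ[X]) ^ n).natDegree = n + n := by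
  have h : (X ^ 2 - 1 : ℝ[X]).natDegree = 2 := natDegree_X_pow_sub_C (r := (1 : ℝ))
  rw [natDegree_pow, h]
  ring

theorem natDegree_legendre_le (n : ℕ) : (legendre n).natDegree ≤ n := by
  refine (natDegree_iterate_derivative _ _).trans ?_
  rw [natDegree_sq_sub_one_pow]
  omega

theorem coeff_legendre (n : ℕ) : (legendre n).coeff n ≠ 0 := by
  have h : ((X ^ 2 - 1 : ℝ[X]) ^ n).coeff (n + n) = 1 := by
    rw [← natDegree_sq_sub_one_pow n]
    exact monic_sq_sub_one_pow n
  rw [legendre, coeff_iterate_derivative, h, nsmul_eq_mul, mul_one, Nat.cast_ne_zero]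
  exact (Nat.descFactorial_pos.2 (by omega)).ne'

theorem legendre_ne_zero (n : ℕ) : legendre n ≠ 0 := fun h => coeff_legendre n (by simp [h])

theorem natDegree_legendre (n : ℕ) : (legendre n).natDegree = n :=
  (natDegree_legendre_le n).antisymm (le_natDegree_of_ne_zero (coeff_legendre n))

/-- The squared norm `∫ L_n²` over `[-1,1]`. -/
def legendreNormSq (n : ℕ) : ℝ := integralPoly (legendre n * legendre n)

theorem legendreNormSq_pos (n : ℕ) : 0 < legendreNormSq n :=
  integralPoly_mul_self_pos (legendre_ne_zero n)

theorem integralPoly_legendre_mul_of_lt {n : ℕ} {q : ℝ[X]} (hq : q.natDegree < n) :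
    integralPoly (legendre n * q) = 0 := by
  have key : ∀ k ≤ n, ∀ q : ℝ[X], integralPoly (derivative^[k] ((X ^ 2 - 1) ^ n) * q) =
      (-1) ^ k * integralPoly ((X ^ 2 - 1) ^ n * derivative^[k] q) := by
    intro k
    induction k with
    | zero => simp
    | succ k ih =>
      intro hk q
      -- The boundary terms vanish: `(t² - 1)^(n-k)` divides the `k`-th derivative.
      have hroot : ∀ t : ℝ, t ^ 2 = 1 → (derivative^[k] ((X ^ 2 - 1 : ℝ[X]) ^ n)).eval t = 0 := by
        intro t ht
        obtain ⟨r, hr⟩ := pow_sub_dvd_iterate_derivative_pow (X ^ 2 - 1 : ℝ[X]) n k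
        rw [hr, eval_mul, eval_pow]
        have h0 : n - k ≠ 0 := by omega
        simp [ht, h0]
      rw [Function.iterate_succ_apply', integralPoly_derivative_mul, ih (by omega), eval_mul,
        eval_mul, hroot 1 (by norm_num), hroot (-1) (by norm_num), Function.iterate_succ_apply]
      ring
  rw [legendre, key n le_rfl, iterate_derivative_eq_zero hq]
  simp

theorem integralPoly_legendre_mul_of_ne {m n : ℕ} (h : m ≠ n) :
    integralPoly (legendre m * legendre n) = 0 := by
  rcases h.lt_or_gt with h | h
  · rw [mul_comm]
    exact integralPoly_legendre_mul_of_lt (by rwa [natDegree_legendre])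
  · exact integralPoly_legendre_mul_of_lt (by rwa [natDegree_legendre])

/-- Legendre's differential equation, obtained by differentiating
`(t² - 1) u' = 2 n t u` for `u = (t² - 1)ⁿ` repeatedly. -/
theorem legendre_ode (n : ℕ) :
    (X ^ 2 - 1) * derivative (derivative (legendre n)) + 2 * X * derivative (legendre n) =
      (n * (n + 1) : ℝ[X]) * legendre n := by
  set u : ℝ[X] := (X ^ 2 - 1) ^ n with hu
  have h0 : (X ^ 2 - 1) * derivative u = 2 * (n : ℝ[X]) * X * u := by
    cases n with
    | zero => simp [hu]
    | succ n =>
      rw [hu, derivative_pow]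
      simp
      ring
  have hC : (C 2 : ℝ[X]) = 2 := map_ofNat C 2
  have key : ∀ k : ℕ, (X ^ 2 - 1) * derivative^[k + 2] u
      + 2 * ((k : ℝ[X]) + 1) * X * derivative^[k + 1] u
      + (k : ℝ[X]) * ((k : ℝ[X]) + 1) * derivative^[k] u
      = 2 * (n : ℝ[X]) * X * derivative^[k + 1] u
        + 2 * (n : ℝ[X]) * ((k : ℝ[X]) + 1) * derivative^[k] u := by
    intro k
    induction k with
    | zero =>
      have h := congrArg derivative h0
      simp only [derivative_mul, derivative_sub, derivative_X_pow, derivative_one, derivative_X,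
        derivative_natCast, derivative_ofNat] at h
      simp only [Function.iterate_succ_apply', Function.iterate_zero_apply]
      simp [hC] at h ⊢
      linear_combination h
    | succ k ih =>
      have h := congrArg derivative ih
      simp only [derivative_mul, derivative_add, derivative_sub, derivative_X_pow, derivative_one,
        derivative_X, derivative_natCast, derivative_ofNat,
        ← Function.iterate_succ_apply' derivative] at h
      simp [hC] at h ⊢
      linear_combination h
  have h := key n
  simp only [Function.iterate_succ_apply'] at h
  change (X ^ 2 - 1) * derivative (derivative (legendre n))
    + 2 * ((n : ℝ[X]) + 1) * X * derivative (legendre n)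
    + (n : ℝ[X]) * ((n : ℝ[X]) + 1) * legendre n
    = 2 * (n : ℝ[X]) * X * derivative (legendre n)
      + 2 * (n : ℝ[X]) * ((n : ℝ[X]) + 1) * legendre n at h
  linear_combination h

theorem derivative_one_sub_sq_mul_derivative_legendre (n : ℕ) :
    derivative ((1 - X ^ 2) * derivative (legendre n)) =
      -((n * (n + 1) : ℝ[X]) * legendre n) := by
  rw [← legendre_ode, derivative_mul]
  simp
  ring

/-- The endpoint values of `L_n` are determined by orthogonality: `(t L_n)' - (n + 1) L_n` has
degree less than `n`, whence `∫ L_n (t L_n)' = (n + 1) ∫ L_n²`. -/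
theorem eval_legendre_sq_add (n : ℕ) :
    (legendre n).eval 1 ^ 2 + (legendre n).eval (-1) ^ 2 = (2 * n + 1) * legendreNormSq n := by
  set L := legendre n with hL
  have hdeg : integralPoly (L * (X * derivative L)) = n * integralPoly (L * L) := by
    rcases Nat.eq_zero_or_pos n with rfl | hn
    · simp [hL, legendre]
    have hlt : (X * derivative L - (n : ℝ[X]) * L).natDegree < n := by
      refine lt_of_le_of_ne ?_ ?_
      · refine (natDegree_sub_le _ _).trans (max_le ?_ ?_)
        · refine natDegree_mul_le.trans ?_
          have := natDegree_derivative_le L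
          have h2 := natDegree_legendre_le n
          rw [natDegree_X]
          rw [← hL] at h2
          omega
        · refine natDegree_mul_le.trans ?_
          rw [natDegree_natCast, zero_add]
          exact natDegree_legendre_le n
      · intro h
        have h3 : (X * derivative L - (n : ℝ[X]) * L).coeff n = 0 := by
          obtain ⟨m, rfl⟩ : ∃ m, n = m + 1 := ⟨n - 1, by omega⟩
          rw [coeff_sub, coeff_X_mul, coeff_derivative, coeff_natCast_mul]
          push_cast
          ring
        have h4 : X * derivative L - (n : ℝ[X]) * L = 0 := by
          rw [← leadingCoeff_eq_zero, leadingCoeff, h, h3]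
        rw [h4, natDegree_zero] at h
        omega
    have h := integralPoly_legendre_mul_of_lt hlt
    rw [← hL, show L * (X * derivative L - (n : ℝ[X]) * L)
      = L * (X * derivative L) - (n : ℝ) • (L * L) by rw [smul_eq_C_mul]; simp; ring,
      map_sub, map_smul, smul_eq_mul] at h
    linarith
  have h := integralPoly_derivative_mul (X * L) L
  have e1 : derivative (X * L) * L = L * L + L * (X * derivative L) := by
    rw [derivative_mul, derivative_X]; ring
  have e2 : X * L * derivative L = L * (X * derivative L) := by ring
  rw [e1, e2, map_add, hdeg] at h
  simp only [eval_mul, eval_X] at h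
  rw [legendreNormSq, ← hL]
  linarith

/-- On `[-1,1]` the polynomial `L_n` is largest at an endpoint (Sonin): with `c = n (n + 1)` the
function `c L_n² + (1 - t²) L_n'²` has derivative `2 t L_n'²`. -/
theorem eval_legendre_sq_le (n : ℕ) {t : ℝ} (ht : t ∈ Icc (-1 : ℝ) 1) :
    (legendre n).eval t ^ 2 ≤ (2 * n + 1) * legendreNormSq n := by
  rw [← eval_legendre_sq_add]
  rcases Nat.eq_zero_or_pos n with rfl | hn
  · simp [legendre]
  set L := legendre n with hL
  have hc : (0 : ℝ) < n * (n + 1) := by positivity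
  have hode : ∀ s : ℝ, (s ^ 2 - 1) * (derivative (derivative L)).eval s
      + 2 * s * (derivative L).eval s = n * (n + 1) * L.eval s := by
    intro s
    simpa using congrArg (Polynomial.eval s) (legendre_ode n)
  set S : ℝ → ℝ := fun s => n * (n + 1) * L.eval s ^ 2 + (1 - s ^ 2) * (derivative L).eval s ^ 2
    with hS
  have hd : ∀ s, HasDerivAt S (2 * s * (derivative L).eval s ^ 2) s := by
    intro s
    have h1 := ((L.hasDerivAt s).pow 2).const_mul ((n : ℝ) * (n + 1))
    have h2 := (((hasDerivAt_id s).pow 2).const_sub 1).mul (((derivative L).hasDerivAt s).pow 2)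
    refine (h1.add h2).congr_deriv ?_
    simp
    linear_combination (-2 * (derivative L).eval s) * hode s
  have hcont : Continuous S := continuous_iff_continuousAt.2 fun s => (hd s).continuousAt
  have hle : n * (n + 1) * L.eval t ^ 2 ≤ S t := by
    have : 0 ≤ (1 - t ^ 2) * (derivative L).eval t ^ 2 :=
      mul_nonneg (by nlinarith [ht.1, ht.2]) (sq_nonneg _)
    simp only [hS]
    linarith
  rcases le_total 0 t with h0 | h0
  · have hm : MonotoneOn S (Ici 0) := by
      refine monotoneOn_of_deriv_nonneg (convex_Ici 0) hcont.continuousOn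
        (fun s _ => (hd s).differentiableAt.differentiableWithinAt) fun s hs => ?_
      rw [interior_Ici, mem_Ioi] at hs
      rw [(hd s).deriv]
      positivity
    have h := hle.trans (hm h0 (zero_le_one' ℝ) ht.2)
    simp only [hS, one_pow, sub_self, zero_mul, add_zero] at h
    linarith [le_of_mul_le_mul_left h hc, sq_nonneg (L.eval (-1))]
  · have hm : AntitoneOn S (Iic 0) := by
      refine antitoneOn_of_deriv_nonpos (convex_Iic 0) hcont.continuousOn
        (fun s _ => (hd s).differentiableAt.differentiableWithinAt) fun s hs => ?_
      rw [interior_Iic, mem_Iio] at hs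
      rw [(hd s).deriv]
      nlinarith [sq_nonneg ((derivative L).eval s)]
    have h := hle.trans (hm (show (-1 : ℝ) ∈ Iic 0 by simp) h0 ht.1)
    simp only [hS, even_two.neg_pow, one_pow, sub_self, zero_mul, add_zero] at h
    linarith [le_of_mul_le_mul_left h hc, sq_nonneg (L.eval 1)]

theorem exists_eq_sum_legendre (m : ℕ) (q : ℝ[X]) (hq : q.natDegree ≤ m) :
    ∃ c : ℕ → ℝ, q = ∑ j ∈ Finset.range (m + 1), c j • legendre j := by
  induction m generalizing q with
  | zero =>
    refine ⟨fun _ => q.coeff 0, ?_⟩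
    rw [eq_C_of_natDegree_le_zero hq]
    simp [legendre, smul_eq_C_mul]
  | succ m ih =>
    set a := q.coeff (m + 1) / (legendre (m + 1)).coeff (m + 1)
    have hr : (q - a • legendre (m + 1)).natDegree ≤ m := by
      refine natDegree_le_iff_coeff_eq_zero.2 fun N hN => ?_
      rw [coeff_sub, coeff_smul, smul_eq_mul]
      rcases (Nat.succ_le_of_lt hN).eq_or_lt with h | h
      · rw [← h, Nat.succ_eq_add_one, div_mul_cancel₀ _ (coeff_legendre _), sub_self]
      · rw [coeff_eq_zero_of_natDegree_lt (hq.trans_lt h),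
          coeff_eq_zero_of_natDegree_lt ((natDegree_legendre_le _).trans_lt h)]
        simp
    obtain ⟨c, hc⟩ := ih _ hr
    refine ⟨fun j => if j = m + 1 then a else c j, ?_⟩
    have hsum : ∑ j ∈ Finset.range (m + 1), (if j = m + 1 then a else c j) • legendre j
        = q - a • legendre (m + 1) := by
      rw [hc]
      refine Finset.sum_congr rfl fun j hj => ?_
      rw [if_neg (Finset.mem_range.1 hj).ne]
    rw [Finset.sum_range_succ, hsum]
    simp

theorem integralPoly_sum_legendre_mul (s : Finset ℕ) (a : ℕ → ℝ) (j : ℕ) :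
    integralPoly ((∑ i ∈ s, a i • legendre i) * legendre j) =
      if j ∈ s then a j * legendreNormSq j else 0 := by
  rw [Finset.sum_mul, map_sum]
  simp_rw [smul_mul_assoc, map_smul, smul_eq_mul]
  have : ∀ i, a i * integralPoly (legendre i * legendre j)
      = if i = j then a j * legendreNormSq j else 0 := by
    intro i
    split_ifs with h
    · rw [h, legendreNormSq]
    · rw [integralPoly_legendre_mul_of_ne h, mul_zero]
  simp_rw [this, Finset.sum_ite_eq']

theorem integralPoly_sum_legendre_mul_sum (s : Finset ℕ) (a b : ℕ → ℝ) :
    integralPoly ((∑ i ∈ s, a i • legendre i) * ∑ j ∈ s, b j • legendre j) =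
      ∑ j ∈ s, a j * b j * legendreNormSq j := by
  rw [Finset.mul_sum, map_sum]
  refine Finset.sum_congr rfl fun j hj => ?_
  rw [mul_smul_comm, map_smul, integralPoly_sum_legendre_mul, if_pos hj, smul_eq_mul]
  ring

/-- Point evaluation at `t ∈ [-1,1]` on polynomials of degree at most `m` is represented by a
polynomial (the Christoffel–Darboux kernel) of squared `L²` norm at most `(m + 1)²`. -/
theorem exists_representer (m : ℕ) {t : ℝ} (ht : t ∈ Icc (-1 : ℝ) 1) :
    ∃ w : ℝ[X], (∀ q : ℝ[X], q.natDegree ≤ m → integralPoly (w * q) = q.eval t) ∧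
      integralPoly (w * w) ≤ ((m : ℝ) + 1) ^ 2 := by
  set a : ℕ → ℝ := fun j => (legendre j).eval t / legendreNormSq j with ha
  refine ⟨∑ j ∈ Finset.range (m + 1), a j • legendre j, fun q hq => ?_, ?_⟩
  · obtain ⟨c, rfl⟩ := exists_eq_sum_legendre m q hq
    rw [integralPoly_sum_legendre_mul_sum, eval_finsetSum]
    refine Finset.sum_congr rfl fun j _ => ?_
    have := (legendreNormSq_pos j).ne'
    rw [eval_smul, smul_eq_mul, ha]
    field_simp
  · rw [integralPoly_sum_legendre_mul_sum]
    have hsum : ∀ m : ℕ, ∑ j ∈ Finset.range (m + 1), (2 * (j : ℝ) + 1) = ((m : ℝ) + 1) ^ 2 := by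
      intro m
      induction m with
      | zero => simp
      | succ m ih => rw [Finset.sum_range_succ, ih]; push_cast; ring
    rw [← hsum]
    refine Finset.sum_le_sum fun j _ => ?_
    have hpos := legendreNormSq_pos j
    have h : a j * a j * legendreNormSq j = (legendre j).eval t ^ 2 / legendreNormSq j := by
      simp only [ha]
      field_simp
    rw [h, div_le_iff₀ hpos]
    exact eval_legendre_sq_le j ht

end Legendre

/-! ### Polynomial approximation on `[-1,1]` -/

theorem sq_integral_mul_le {α : Type*} [MeasurableSpace α] {μ : Measure α} {f g : α → ℝ}
    (hf : MemLp f 2 μ) (hg : MemLp g 2 μ) :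
    (∫ a, f a * g a ∂μ) ^ 2 ≤ (∫ a, f a ^ 2 ∂μ) * ∫ a, g a ^ 2 ∂μ := by
  have h1 := hf.integrable_sq
  have h2 := hg.integrable_sq
  have h3 : Integrable (fun a => f a * g a) μ := hf.integrable_mul hg
  have key : ∀ x : ℝ, 0 ≤ (∫ a, f a ^ 2 ∂μ) * (x * x) + (2 * ∫ a, f a * g a ∂μ) * x
      + ∫ a, g a ^ 2 ∂μ := by
    intro x
    have : ∫ a, (x * f a + g a) ^ 2 ∂μ = (∫ a, f a ^ 2 ∂μ) * (x * x)
        + (2 * ∫ a, f a * g a ∂μ) * x + ∫ a, g a ^ 2 ∂μ := by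
      have h4 : Integrable (fun a => 2 * (f a * g a) * x) μ := (h3.const_mul 2).mul_const x
      have h5 : Integrable (fun a => f a ^ 2 * (x * x) + 2 * (f a * g a) * x) μ :=
        (h1.mul_const (x * x)).add h4
      rw [← integral_mul_const, ← integral_const_mul, ← integral_mul_const,
        ← integral_add (h1.mul_const _) h4, ← integral_add h5 h2]
      exact integral_congr_ae (Filter.Eventually.of_forall fun a => by ring)
    rw [← this]
    exact integral_nonneg fun a => sq_nonneg _
  have := discrim_le_zero key
  rw [discrim] at this
  nlinarith

noncomputable section Approximation

/-- Lebesgue measure on `[-1,1]`. -/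
abbrev lebI : Measure ℝ := volume.restrict (Icc (-1 : ℝ) 1)

theorem intervalIntegral_eq_lebI (f : ℝ → ℝ) : ∫ t in (-1 : ℝ)..1, f t = ∫ t, f t ∂lebI := by
  rw [intervalIntegral.integral_of_le (by norm_num), integral_Icc_eq_integral_Ioc]

theorem integralPoly_eq_lebI (p : ℝ[X]) : integralPoly p = ∫ t, p.eval t ∂lebI :=
  intervalIntegral_eq_lebI _

theorem integralPoly_sq_eq_lebI (p : ℝ[X]) : integralPoly (p * p) = ∫ t, p.eval t ^ 2 ∂lebI := by
  simp_rw [integralPoly_eq_lebI, eval_mul, sq]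

theorem memLp_of_continuousOn {f : ℝ → ℝ} (hf : ContinuousOn f (Icc (-1) 1)) :
    MemLp f 2 lebI := by
  obtain ⟨C, hC⟩ := isCompact_Icc.exists_bound_of_continuousOn hf
  refine MemLp.of_bound (hf.aestronglyMeasurable measurableSet_Icc) C ?_
  exact (ae_restrict_iff' measurableSet_Icc).2 (Filter.Eventually.of_forall hC)

theorem memLp_poly (p : ℝ[X]) : MemLp (fun t => p.eval t) 2 lebI :=
  memLp_of_continuousOn p.continuous.continuousOn

/-- `f` is absolutely continuous on `[-1,1]` with almost everywhere derivative `h`. -/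
def HasAEDeriv (f h : ℝ → ℝ) : Prop :=
  AbsolutelyContinuousOnInterval f (-1) 1 ∧ ∀ᵐ t ∂lebI, HasDerivAt f (h t) t

theorem absolutelyContinuousOnInterval_poly (p : ℝ[X]) :
    AbsolutelyContinuousOnInterval (fun t => p.eval t) (-1) 1 := by
  have h : ContDiff ℝ 1 fun t : ℝ => p.eval t := by
    simpa [coe_aeval_eq_eval] using p.contDiff_aeval (𝕜 := ℝ) 1
  exact h.contDiffOn.absolutelyContinuousOnInterval

namespace HasAEDeriv

variable {f h : ℝ → ℝ}

theorem continuousOn (H : HasAEDeriv f h) : ContinuousOn f (Icc (-1) 1) := by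
  have := H.1.continuousOn
  rwa [uIcc_of_le (by norm_num)] at this

theorem ae_deriv (H : HasAEDeriv f h) : deriv f =ᵐ[lebI] h := by
  filter_upwards [H.2] with t ht using ht.deriv

theorem aestronglyMeasurable (H : HasAEDeriv f h) : AEStronglyMeasurable h lebI :=
  (measurable_deriv f).aestronglyMeasurable.congr H.ae_deriv

theorem sub_poly (H : HasAEDeriv f h) (p : ℝ[X]) :
    HasAEDeriv (fun t => f t - p.eval t) fun t => h t - (derivative p).eval t := by
  refine ⟨H.1.fun_sub (absolutelyContinuousOnInterval_poly p), ?_⟩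
  filter_upwards [H.2] with t ht using ht.sub (p.hasDerivAt t)

theorem integral_mul_derivative (H : HasAEDeriv f h) (p : ℝ[X]) (h1 : p.eval 1 = 0)
    (h2 : p.eval (-1) = 0) :
    ∫ t, f t * (derivative p).eval t ∂lebI = -∫ t, h t * p.eval t ∂lebI := by
  have e := H.1.integral_mul_deriv_eq_deriv_mul (absolutelyContinuousOnInterval_poly p)
  rw [h1, h2, mul_zero, mul_zero, sub_zero, zero_sub, intervalIntegral_eq_lebI,
    intervalIntegral_eq_lebI] at e
  simp only [Polynomial.deriv] at e
  rw [e]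
  congr 1
  refine integral_congr_ae ?_
  filter_upwards [H.ae_deriv] with t ht
  rw [ht]

theorem abs_sub_le (H : HasAEDeriv f h) (hh : MemLp h 2 lebI) {B : ℝ} (hB : 0 ≤ B)
    (hhB : ∫ t, h t ^ 2 ∂lebI ≤ B ^ 2) {t : ℝ} (ht : t ∈ Icc (-1 : ℝ) 1) :
    |f t - f (-1)| ≤ 2 * B := by
  have hAC := H.1.mono (c := -1) (d := t) (by
    rw [uIcc_of_le ht.1, uIcc_of_le (by norm_num)]
    exact Icc_subset_Icc le_rfl ht.2)
  have habs : MemLp (fun s => |h s|) 2 lebI := hh.abs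
  have hcs := sq_integral_mul_le habs (memLp_poly 1)
  have hone : ∫ t, (1 : ℝ[X]).eval t ^ 2 ∂lebI = 2 := by
    simp only [eval_one, one_pow]
    rw [← intervalIntegral_eq_lebI]
    norm_num
  rw [hone] at hcs
  simp only [eval_one, mul_one, sq_abs] at hcs
  have hle : |f t - f (-1)| ≤ ∫ s, |h s| ∂lebI := by
    rw [← hAC.integral_deriv_eq_sub, intervalIntegral.integral_of_le ht.1]
    refine (abs_integral_le_integral_abs).trans ?_
    have hsub : Ioc (-1) t ⊆ Icc (-1 : ℝ) 1 := fun s hs => ⟨hs.1.le, hs.2.trans ht.2⟩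
    have hint : Integrable (fun s => |h s|) lebI :=
      (hh.integrable (by norm_num)).abs
    refine (setIntegral_mono_set (s := Ioc (-1) t) (t := Icc (-1) 1) (f := fun s => |deriv f s|)
      ?_ (Filter.Eventually.of_forall fun s => abs_nonneg _)
      (Filter.Eventually.of_forall hsub)).trans_eq ?_
    · refine hint.congr ?_
      filter_upwards [H.ae_deriv] with s hs
      rw [hs]
    · refine integral_congr_ae ?_
      filter_upwards [H.ae_deriv] with s hs
      rw [hs]
  have hI : 0 ≤ ∫ s, |h s| ∂lebI := integral_nonneg fun s => abs_nonneg _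
  refine hle.trans (abs_le_of_sq_le_sq' ?_ (by positivity)).2
  nlinarith

end HasAEDeriv

/-- The Legendre coefficient `∫ f L_j / ∫ L_j²`. -/
def legendreCoeff (f : ℝ → ℝ) (j : ℕ) : ℝ :=
  (∫ t, f t * (legendre j).eval t ∂lebI) / legendreNormSq j

/-- The Legendre partial sum `∑_{j ≤ n} c_j L_j`, which is the orthogonal projection of `f` onto
the polynomials of degree at most `n`. -/
def legendreSum (f : ℝ → ℝ) (n : ℕ) : ℝ[X] :=
  ∑ j ∈ Finset.range (n + 1), legendreCoeff f j • legendre j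

theorem natDegree_legendreSum_le (f : ℝ → ℝ) (n : ℕ) : (legendreSum f n).natDegree ≤ n := by
  refine natDegree_sum_le_of_forall_le _ _ fun j hj => (natDegree_smul_le _ _).trans ?_
  exact (natDegree_legendre_le j).trans (Nat.lt_succ_iff.1 (Finset.mem_range.1 hj))

theorem integral_mul_sum_legendre {f : ℝ → ℝ} (hf : MemLp f 2 lebI) (s : Finset ℕ) (a : ℕ → ℝ) :
    ∫ t, f t * (∑ j ∈ s, a j • legendre j).eval t ∂lebI =
      ∑ j ∈ s, a j * (legendreCoeff f j * legendreNormSq j) := by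
  simp_rw [eval_finsetSum, Finset.mul_sum, eval_smul, smul_eq_mul]
  rw [integral_finsetSum]
  · refine Finset.sum_congr rfl fun j _ => ?_
    rw [legendreCoeff, div_mul_cancel₀ _ (legendreNormSq_pos j).ne', ← integral_const_mul]
    exact integral_congr_ae (Filter.Eventually.of_forall fun t => by ring)
  · intro j _
    exact hf.integrable_mul ((memLp_poly (legendre j)).const_mul (a j))

theorem integral_sub_legendreSum_mul {f : ℝ → ℝ} (hf : MemLp f 2 lebI) {n : ℕ} {r : ℝ[X]}
    (hr : r.natDegree ≤ n) :
    ∫ t, (f t - (legendreSum f n).eval t) * r.eval t ∂lebI = 0 := by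
  have e : ∫ t, f t * r.eval t ∂lebI = integralPoly (legendreSum f n * r) := by
    obtain ⟨a, rfl⟩ := exists_eq_sum_legendre n r hr
    rw [integral_mul_sum_legendre hf, legendreSum, integralPoly_sum_legendre_mul_sum]
    exact Finset.sum_congr rfl fun j _ => by ring
  have h1 : Integrable (fun t => f t * r.eval t) lebI := hf.integrable_mul (memLp_poly r)
  have h2 : Integrable (fun t => (legendreSum f n).eval t * r.eval t) lebI :=
    (memLp_poly _).integrable_mul (memLp_poly r)
  simp_rw [sub_mul]
  rw [integral_sub h1 h2, e, integralPoly_eq_lebI]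
  simp

theorem integral_sub_legendreSum_add_sq {f : ℝ → ℝ} (hf : MemLp f 2 lebI) {n : ℕ} {r : ℝ[X]}
    (hr : r.natDegree ≤ n) :
    ∫ t, (f t - (legendreSum f n).eval t + r.eval t) ^ 2 ∂lebI =
      ∫ t, (f t - (legendreSum f n).eval t) ^ 2 ∂lebI + integralPoly (r * r) := by
  have hu : MemLp (fun t => f t - (legendreSum f n).eval t) 2 lebI := hf.sub (memLp_poly _)
  have h1 := integral_sub_legendreSum_mul hf hr
  have h2 : Integrable (fun t => (f t - (legendreSum f n).eval t) * r.eval t) lebI :=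
    hu.integrable_mul (memLp_poly r)
  have h3 := (memLp_poly r).integrable_sq
  have e : ∀ t, (f t - (legendreSum f n).eval t + r.eval t) ^ 2 =
      (f t - (legendreSum f n).eval t) ^ 2 +
        (2 * ((f t - (legendreSum f n).eval t) * r.eval t) + r.eval t ^ 2) := fun t => by ring
  have h4 : Integrable (fun t => 2 * ((f t - (legendreSum f n).eval t) * r.eval t)
      + r.eval t ^ 2) lebI := (h2.const_mul 2).add h3
  simp_rw [e]
  rw [integral_add hu.integrable_sq h4, integral_add (h2.const_mul 2) h3,
    integral_const_mul, h1, integralPoly_sq_eq_lebI]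
  ring

/-- A block `r = ∑ c_j L_j`, all `j > n`, of the Legendre series of an absolutely continuous `f`
has `L²` norm at most `‖f'‖ / (n + 1)`: it equals `-((1 - t²) R')'` with
`R = ∑ c_j / (j (j + 1)) L_j`, so that `∫ r² = ∫ f r = ∫ f' (1 - t²) R'` by parts, while
`∫ (1 - t²) R'² = ∫ r R ≤ ∫ r² / (n + 1)²`. -/
theorem HasAEDeriv.legendreBlock_le {f h : ℝ → ℝ} (H : HasAEDeriv f h) (hh : MemLp h 2 lebI)
    {B : ℝ} (hB : ∫ t, h t ^ 2 ∂lebI ≤ B ^ 2) {n : ℕ} {s : Finset ℕ} (hs : ∀ j ∈ s, n + 1 ≤ j) :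
    integralPoly ((∑ j ∈ s, legendreCoeff f j • legendre j) *
      ∑ j ∈ s, legendreCoeff f j • legendre j) ≤ (B / (n + 1)) ^ 2 := by
  set c := legendreCoeff f with hc
  set r := ∑ j ∈ s, c j • legendre j with hr
  set R := ∑ j ∈ s, (c j / (j * (j + 1))) • legendre j with hR
  set G := (1 - X ^ 2) * derivative R with hG
  have hf : MemLp f 2 lebI := memLp_of_continuousOn H.continuousOn
  have hGr : derivative G = -r := by
    rw [hG, hR, derivative_sum, Finset.mul_sum, derivative_sum, hr, ← Finset.sum_neg_distrib]
    refine Finset.sum_congr rfl fun j hj => ?_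
    have hj0 : (j : ℝ) * (j + 1) ≠ 0 := by
      have : 0 < j := by have := hs j hj; omega
      positivity
    rw [derivative_smul, mul_smul_comm, derivative_smul,
      derivative_one_sub_sq_mul_derivative_legendre, smul_neg]
    have e : ((j : ℝ[X]) * (j + 1)) * legendre j = ((j : ℝ) * (j + 1)) • legendre j := by
      rw [smul_eq_C_mul]; simp
    rw [e, smul_smul, div_mul_cancel₀ _ hj0]
  have hG1 : G.eval 1 = 0 := by simp [hG]
  have hG2 : G.eval (-1) = 0 := by simp [hG]
  set Q := integralPoly (r * r) with hQ
  have hQ0 : 0 ≤ Q := integralPoly_mul_self_nonneg r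
  have e1 : Q = ∫ t, h t * G.eval t ∂lebI := by
    have h1 := H.integral_mul_derivative G hG1 hG2
    have h2 := integral_mul_sum_legendre hf s c
    rw [hGr] at h1
    simp only [eval_neg, mul_neg, integral_neg, neg_inj] at h1
    rw [← h1, h2, hQ, hr, integralPoly_sum_legendre_mul_sum]
    exact Finset.sum_congr rfl fun j _ => by ring
  have e2 : integralPoly (G * derivative R) = integralPoly (r * R) := by
    have h1 := integralPoly_derivative_mul G R
    rw [eval_mul (p := G) (q := R), eval_mul (p := G) (q := R), hG1, hG2, hGr, neg_mul,
      map_neg] at h1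
    linarith
  have e3 : integralPoly (r * R) ≤ Q / (n + 1) ^ 2 := by
    rw [hQ, hr, hR, integralPoly_sum_legendre_mul_sum, integralPoly_sum_legendre_mul_sum,
      Finset.sum_div]
    refine Finset.sum_le_sum fun j hj => ?_
    have hj1 : (n : ℝ) + 1 ≤ j := by exact_mod_cast hs j hj
    have hpos := legendreNormSq_pos j
    have hn : (0 : ℝ) ≤ n := n.cast_nonneg
    rw [show c j * (c j / (j * (j + 1))) * legendreNormSq j
      = c j * c j * legendreNormSq j / (j * (j + 1)) by ring]
    refine div_le_div_of_nonneg_left (mul_nonneg (mul_self_nonneg _) hpos.le) (by positivity) ?_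
    nlinarith
  have e4 : ∫ t, G.eval t ^ 2 ∂lebI ≤ integralPoly (G * derivative R) := by
    rw [integralPoly_eq_lebI]
    refine setIntegral_mono_on (memLp_poly G).integrable_sq
      (G * derivative R).continuous.continuousOn.integrableOn_Icc measurableSet_Icc fun t ht => ?_
    have h0 : 0 ≤ 1 - t ^ 2 := by nlinarith [ht.1, ht.2]
    have h1 : (1 - t ^ 2) ^ 2 ≤ 1 - t ^ 2 := by nlinarith [sq_nonneg t]
    simp only [hG, eval_mul, eval_sub, eval_one, eval_pow, eval_X]
    nlinarith [mul_le_mul_of_nonneg_right h1 (sq_nonneg ((derivative R).eval t))]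
  have e5 := sq_integral_mul_le hh (memLp_poly G)
  rw [← e1] at e5
  have hG0 : 0 ≤ ∫ t, G.eval t ^ 2 ∂lebI := integral_nonneg fun t => sq_nonneg _
  have e6 : Q ^ 2 ≤ B ^ 2 * (Q / (n + 1) ^ 2) :=
    e5.trans (mul_le_mul hB (e4.trans (e2.le.trans e3)) hG0 (sq_nonneg _))
  rcases hQ0.eq_or_lt with h0 | h0
  · rw [← h0]; positivity
  · refine le_of_mul_le_mul_right ?_ h0
    calc Q * Q = Q ^ 2 := by ring
      _ ≤ _ := e6
      _ = _ := by rw [div_pow]; ring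

/-- A Jackson inequality in `L²(-1,1)`: the error of the Legendre partial sum of degree `n` is at
most `‖f'‖ / (n + 1)`. -/
theorem HasAEDeriv.integral_sub_legendreSum_sq_le {f h : ℝ → ℝ} (H : HasAEDeriv f h)
    (hh : MemLp h 2 lebI) {B : ℝ} (hB : ∫ t, h t ^ 2 ∂lebI ≤ B ^ 2) (n : ℕ) :
    ∫ t, (f t - (legendreSum f n).eval t) ^ 2 ∂lebI ≤ (B / (n + 1)) ^ 2 := by
  have hf : MemLp f 2 lebI := memLp_of_continuousOn H.continuousOn
  refine le_of_forall_pos_le_add fun ε hε => ?_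
  obtain ⟨p, hp⟩ := exists_polynomial_near_of_continuousOn (-1) 1 f H.continuousOn (√(ε / 2))
    (by positivity)
  -- By Weierstrass the partial sum of a high degree `N` has squared error at most `ε`.
  set N := max n p.natDegree with hN
  have h1 : ∫ t, (f t - (legendreSum f N).eval t) ^ 2 ∂lebI ≤ ε := by
    have e := integral_sub_legendreSum_add_sq hf (n := N) (r := legendreSum f N - p)
      ((natDegree_sub_le _ _).trans (max_le (natDegree_legendreSum_le f N) (le_max_right _ _)))
    have hle : ∫ t, (f t - (legendreSum f N).eval t + (legendreSum f N - p).eval t) ^ 2 ∂lebI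
        ≤ ε := by
      have hc : ∫ _, ε / 2 ∂lebI = ε := by
        rw [← intervalIntegral_eq_lebI]
        simp
        ring
      rw [← hc]
      refine setIntegral_mono_on ?_ (integrable_const _) measurableSet_Icc fun t ht => ?_
      · refine ((hf.sub (memLp_poly (legendreSum f N))).add
          (memLp_poly (legendreSum f N - p))).integrable_sq
      · have := hp t ht
        rw [abs_lt] at this
        have hsq := Real.sq_sqrt (show 0 ≤ ε / 2 by positivity)
        rw [eval_sub, sub_add_sub_cancel]
        nlinarith
    have := integralPoly_mul_self_nonneg (legendreSum f N - p)
    linarith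
  have hdec : legendreSum f N - legendreSum f n
      = ∑ j ∈ Finset.Ico (n + 1) (N + 1), legendreCoeff f j • legendre j := by
    rw [legendreSum, legendreSum, Finset.sum_Ico_eq_sub]
    have := le_max_left n p.natDegree
    omega
  have h2 := integral_sub_legendreSum_add_sq hf (n := N) (r := legendreSum f N - legendreSum f n)
    ((natDegree_sub_le _ _).trans (max_le (natDegree_legendreSum_le f N)
      ((natDegree_legendreSum_le f n).trans (le_max_left _ _))))
  have h3 := H.legendreBlock_le hh hB (n := n) (s := Finset.Ico (n + 1) (N + 1))
    fun j hj => (Finset.mem_Ico.1 hj).1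
  rw [← hdec] at h3
  simp only [eval_sub, sub_add_sub_cancel] at h2
  linarith

theorem exists_derivative_eq (q : ℝ[X]) :
    ∃ Q : ℝ[X], derivative Q = q ∧ Q.natDegree ≤ q.natDegree + 1 := by
  refine ⟨∑ i ∈ Finset.range (q.natDegree + 1), C (q.coeff i / (i + 1)) * X ^ (i + 1), ?_, ?_⟩
  · rw [derivative_sum]
    conv_rhs => rw [q.as_sum_range_C_mul_X_pow]
    refine Finset.sum_congr rfl fun i _ => ?_
    rw [derivative_C_mul_X_pow]
    congr 2
    have : (i : ℝ) + 1 ≠ 0 := by positivity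
    push_cast
    field_simp
  · refine natDegree_sum_le_of_forall_le _ _ fun i hi => (natDegree_C_mul_X_pow_le _ _).trans ?_
    exact Finset.mem_range.1 hi

/-- Iterating the Jackson inequality along a chain `g 0, …, g s` of derivatives. -/
theorem exists_poly_L2_near (s m : ℕ) (g : ℕ → ℝ → ℝ) (hg : ∀ j < s, HasAEDeriv (g j) (g (j + 1)))
    (hs : MemLp (g s) 2 lebI) {B : ℝ} (hB : ∫ t, g s t ^ 2 ∂lebI ≤ B ^ 2) :
    ∃ q : ℝ[X], q.natDegree ≤ m + s ∧ MemLp (g 0) 2 lebI ∧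
      ∫ t, (g 0 t - q.eval t) ^ 2 ∂lebI ≤ (B / (m + 1) ^ s) ^ 2 := by
  induction s generalizing g with
  | zero => exact ⟨0, by simp, hs, by simpa using hB⟩
  | succ s ih =>
    obtain ⟨q, hq, hm, hqB⟩ := ih (fun j => g (j + 1)) (fun j hj => hg (j + 1) (by omega)) hs hB
    obtain ⟨Q, hQ, hQd⟩ := exists_derivative_eq q
    have H := (hg 0 (by omega)).sub_poly Q
    rw [hQ] at H
    refine ⟨Q + legendreSum (fun t => g 0 t - Q.eval t) (m + s + 1), ?_,
      memLp_of_continuousOn (hg 0 (by omega)).continuousOn, ?_⟩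
    · exact (natDegree_add_le _ _).trans (max_le (by omega) (natDegree_legendreSum_le _ _))
    · have h := H.integral_sub_legendreSum_sq_le (hm.sub (memLp_poly q)) hqB (m + s + 1)
      simp only [eval_add, ← sub_sub]
      refine h.trans ?_
      rw [← sq_abs, ← sq_abs (B / _)]
      refine pow_le_pow_left₀ (abs_nonneg _) ?_ 2
      rw [abs_div, abs_div, abs_div, div_div, pow_succ]
      have h1 : (0 : ℝ) < m + 1 := by positivity
      have h2 : (m : ℝ) + 1 ≤ ((m + s + 1 : ℕ) : ℝ) + 1 := by
        push_cast
        linarith [(s.cast_nonneg : (0 : ℝ) ≤ s)]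
      rw [abs_of_pos (by positivity : (0 : ℝ) < (m + 1) ^ s), abs_of_pos (h1.trans_le h2),
        abs_of_pos (by positivity : (0 : ℝ) < (m + 1) ^ s * (m + 1))]
      gcongr

/-- Uniform approximation: the function at the start of a chain of `s + 1` derivatives, the last of
which has `L²` norm at most `B`, is approximated in degree `m + s + 1` with error
`2 B / (m + 1)^s`. -/
theorem exists_poly_near (s m : ℕ) (g : ℕ → ℝ → ℝ)
    (hg : ∀ j < s + 1, HasAEDeriv (g j) (g (j + 1)))
    (hs : MemLp (g (s + 1)) 2 lebI) {B : ℝ} (hB0 : 0 ≤ B)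
    (hB : ∫ t, g (s + 1) t ^ 2 ∂lebI ≤ B ^ 2) :
    ∃ q : ℝ[X], q.natDegree ≤ m + s + 1 ∧
      ∀ t ∈ Icc (-1 : ℝ) 1, |g 0 t - q.eval t| ≤ 2 * (B / (m + 1) ^ s) := by
  obtain ⟨q, hq, hm, hqB⟩ := exists_poly_L2_near s m (fun j => g (j + 1))
    (fun j hj => hg (j + 1) (by omega)) hs hB
  obtain ⟨Q, hQ, hQd⟩ := exists_derivative_eq q
  have H := (hg 0 (by omega)).sub_poly Q
  rw [hQ] at H
  refine ⟨Q + C (g 0 (-1) - Q.eval (-1)), ?_, fun t ht => ?_⟩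
  · exact (natDegree_add_le _ _).trans (max_le (by omega) (by simp))
  · have h := H.abs_sub_le (hm.sub (memLp_poly q)) (by positivity) hqB ht
    rwa [eval_add, eval_C, ← sub_sub]

end Approximation

/-! ### Degrees of freedom and reproducing weights on the cube -/

theorem kernel_symm {X : Type*} (k : X → X → ℝ) [Fact (Matrix.of k).PosSemidef] (x y : X) :
    k x y = k y x := by
  rw [← pointEval_apply k y x, ← inner_pointEval, real_inner_comm, inner_pointEval,
    pointEval_apply]

section DegreesOfFreedom

variable {X : Type*} {k : X → X → ℝ} [Fact (Matrix.of k).PosSemidef] [TopologicalSpace X]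

theorem continuous_coe_kernelSpace (hc : Continuous fun q : X × X => k q.1 q.2)
    (f : KernelSpace k) : Continuous fun z => f z := by
  have := continuous_pointEval hc
  simp_rw [← inner_pointEval]
  fun_prop

variable [CompactSpace X] [MeasurableSpace X] [BorelSpace X]

theorem memLp_of_continuous {μ : Measure X} [IsFiniteMeasure μ] {f : X → ℝ} (hf : Continuous f) :
    MemLp f 2 μ := by
  obtain ⟨C, hC⟩ := isCompact_univ.exists_bound_of_continuousOn hf.continuousOn
  exact MemLp.of_bound hf.aestronglyMeasurable C
    (Filter.Eventually.of_forall fun x => hC x (mem_univ x))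

variable [T2Space X]

theorem inner_integral_smul_pointEval (hc : Continuous fun q : X × X => k q.1 q.2)
    (μ : Measure X) [IsFiniteMeasure μ] {w : X → ℝ} (hw : Continuous w) (f : KernelSpace k) :
    inner ℝ (∫ z, w z • pointEval k z ∂μ) f = ∫ z, w z * f z ∂μ := by
  have hint : Integrable (fun z => w z • pointEval k z) μ := by
    rw [← integrableOn_univ]
    exact (hw.smul (continuous_pointEval hc)).continuousOn.integrableOn_compact isCompact_univ
  rw [real_inner_comm, ← integral_inner hint]
  refine integral_congr_ae (Filter.Eventually.of_forall fun z => ?_)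
  simp only
  rw [inner_smul_right, real_inner_comm, inner_pointEval]

/-- If the signed measure `w μ` reproduces at `x` a kernel `k₀` that is `ε`-close to `k`, then
`k_x` is close to `∫ w(z) k_z dμ(z)` in `H_k`. -/
theorem norm_pointEval_sub_integral_sq_le (hc : Continuous fun q : X × X => k q.1 q.2)
    (μ : Measure X) [IsProbabilityMeasure μ]
    (x : X) {w : X → ℝ} (hw : Continuous w) {A : ℝ} (hA1 : 1 ≤ A) (hA : ∫ z, w z ^ 2 ∂μ ≤ A)
    {k₀ : X → X → ℝ} (hk₀ : ∀ z, Continuous (k₀ z)) {ε : ℝ} (hε : ∀ z y, |k z y - k₀ z y| ≤ ε)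
    (hrep : ∀ z, ∫ y, w y * k₀ z y ∂μ = k₀ z x) :
    ‖pointEval k x - ∫ z, w z • pointEval k z ∂μ‖ ^ 2 ≤ 4 * ε * A := by
  have hε0 : 0 ≤ ε := (abs_nonneg _).trans (hε x x)
  set v := pointEval k x - ∫ z, w z • pointEval k z ∂μ with hv
  have hvg : ∀ g : KernelSpace k, inner ℝ v g = g x - ∫ z, w z * g z ∂μ := fun g => by
    rw [hv, inner_sub_left, inner_pointEval, inner_integral_smul_pointEval hc μ hw]
  set W := ∫ z, |w z| ∂μ with hW
  have hW0 : 0 ≤ W := integral_nonneg fun z => abs_nonneg _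
  have hwint : Integrable (fun z => |w z|) μ :=
    ((memLp_of_continuous hw).integrable (by norm_num)).abs
  have hWA : W ^ 2 ≤ A := by
    have h := sq_integral_mul_le (μ := μ) (memLp_of_continuous hw.abs)
      (memLp_of_continuous (continuous_const (y := (1 : ℝ))))
    simp only [mul_one, sq_abs, one_pow, integral_const, probReal_univ, smul_eq_mul] at h
    exact h.trans hA
  have hbd : ∀ (g : X → ℝ) (b : ℝ), (∀ z, |g z| ≤ b) → |∫ z, w z * g z ∂μ| ≤ b * W := by
    intro g b hg
    rw [hW, ← integral_const_mul, ← Real.norm_eq_abs]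
    refine norm_integral_le_of_norm_le (hwint.const_mul b)
      (Filter.Eventually.of_forall fun z => ?_)
    rw [Real.norm_eq_abs, abs_mul, mul_comm]
    exact mul_le_mul_of_nonneg_right (hg z) (abs_nonneg _)
  have hvz : ∀ z, |v z| ≤ ε * (1 + W) := by
    intro z
    have h1 : v z = k z x - ∫ y, w y * k z y ∂μ := by
      rw [← inner_pointEval, real_inner_comm, hvg, pointEval_apply, kernel_symm k x z]
      simp_rw [pointEval_apply, kernel_symm k _ z]
    have hcz : Continuous (k z) := hc.comp (continuous_const.prodMk continuous_id)
    have hi1 : Integrable (fun y => w y * k z y) μ :=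
      (memLp_of_continuous hw).integrable_mul (memLp_of_continuous hcz)
    have hi2 : Integrable (fun y => w y * k₀ z y) μ :=
      (memLp_of_continuous hw).integrable_mul (memLp_of_continuous (hk₀ z))
    have h2 : v z = (k z x - k₀ z x) - ∫ y, w y * (k z y - k₀ z y) ∂μ := by
      simp_rw [mul_sub]
      rw [integral_sub hi1 hi2, hrep, h1]
      ring
    rw [h2]
    refine (abs_sub _ _).trans ?_
    linarith [hε z x, hbd (fun y => k z y - k₀ z y) ε (hε z)]
  rw [← real_inner_self_eq_norm_sq, hvg]
  have h1 := abs_le.1 (hbd (fun z => v z) _ hvz)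
  have h2 := abs_le.1 (hvz x)
  have h3 : ε * (1 + W) + ε * (1 + W) * W = ε * (1 + W) ^ 2 := by ring
  have h4 : (1 + W) ^ 2 ≤ 4 * A := by nlinarith [sq_nonneg (1 - W)]
  nlinarith [mul_le_mul_of_nonneg_left h4 hε0]

theorem le_of_add_eq_of_sq_le {y u v I J A b e : ℝ} (hA : 0 ≤ A) (hb : 0 ≤ b) (he : 0 ≤ e)
    (hI : 0 ≤ I) (hJ : 0 ≤ J) (hy : y = I + J) (hyuv : y = u + v) (hu : u ^ 2 ≤ A * (b * I))
    (hv : v ^ 2 ≤ A * (e * J)) : y ≤ 2 * A * (b + e) := by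
  have hsq : y * y ≤ 2 * A * (b + e) * y := by
    have h1 : 0 ≤ A * b * J := by positivity
    have h2 : 0 ≤ A * e * I := by positivity
    calc y * y = (u + v) ^ 2 := by rw [hyuv]; ring
      _ ≤ 2 * (u ^ 2 + v ^ 2) := add_sq_le
      _ ≤ 2 * A * (b + e) * (I + J) := by linarith
      _ = _ := by rw [← hy]
  rcases le_or_gt y 0 with h0 | h0
  · exact h0.trans (by positivity)
  · exact le_of_mul_le_mul_right hsq h0

/-- The marginal degrees of freedom at `x` are controlled by any weight `w` for which the signed
measure `w μ` reproduces at `x` a kernel `k₀` close to `k`. With `f = (l + L_k)⁻¹ k_x` one has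
`f x = ∫ f² dP + l ‖f‖²`, and `f x = ∫ w f dμ + ⟨v, f⟩` for the element `v = k_x - ∫ w(z) k_z dμ`,
whose norm only sees `k - k₀`. -/
theorem inner_pointEval_inverse_le (hc : Continuous fun q : X × X => k q.1 q.2)
    (P μ : Measure X) [IsFiniteMeasure P] [IsProbabilityMeasure μ] {a : ℝ} (ha : 0 < a)
    (hP : ∀ f : X → ℝ, Continuous f → a * ∫ z, f z ^ 2 ∂μ ≤ ∫ z, f z ^ 2 ∂P)
    (x : X) {w : X → ℝ} (hw : Continuous w) {A : ℝ} (hA1 : 1 ≤ A) (hA : ∫ z, w z ^ 2 ∂μ ≤ A)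
    {k₀ : X → X → ℝ} (hk₀ : ∀ z, Continuous (k₀ z)) {ε : ℝ} (hε : ∀ z y, |k z y - k₀ z y| ≤ ε)
    (hrep : ∀ z, ∫ y, w y * k₀ z y ∂μ = k₀ z x) {l c : ℝ} (hl : 0 < l) (hεl : ε ≤ c * l) :
    inner ℝ (pointEval k x)
      (Ring.inverse (l • (1 : KernelSpace k →L[ℝ] KernelSpace k) + intOp hc P)
        (pointEval k x)) ≤ 2 * A * (1 / a + 4 * c) := by
  have hvn := norm_pointEval_sub_integral_sq_le hc μ x hw hA1 hA hk₀ hε hrep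
  have hε0 : 0 ≤ ε := (abs_nonneg _).trans (hε x x)
  have hc0 : 0 ≤ c := by
    by_contra! h
    nlinarith
  set f := Ring.inverse (l • (1 : KernelSpace k →L[ℝ] KernelSpace k) + intOp hc P)
    (pointEval k x) with hf
  have hTf : l • f + intOp hc P f = pointEval k x := by
    have h := Ring.mul_inverse_cancel _ (isUnit_add_intOp hc P hl)
    exact congrArg (fun S : KernelSpace k →L[ℝ] KernelSpace k => S (pointEval k x)) h
  clear_value f
  rw [inner_pointEval]
  set v := pointEval k x - ∫ z, w z • pointEval k z ∂μ with hv
  have hcf := continuous_coe_kernelSpace hc f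
  have hfx : f x = ∫ z, f z ^ 2 ∂P + l * ‖f‖ ^ 2 := by
    have h1 : inner ℝ (intOp hc P f) f = ∫ z, f z * f z ∂P :=
      inner_integral_smul_pointEval hc P hcf f
    rw [← inner_pointEval, ← hTf, inner_add_left, real_inner_smul_left, h1,
      real_inner_self_eq_norm_sq, add_comm]
    simp_rw [sq]
  have hfd : f x = ∫ z, w z * f z ∂μ + inner ℝ v f := by
    rw [hv, inner_sub_left, inner_pointEval, inner_integral_smul_pointEval hc μ hw]
    ring
  refine le_of_add_eq_of_sq_le (by linarith) (by positivity) (by positivity)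
    (integral_nonneg fun z => sq_nonneg _) (by positivity) hfx hfd ?_ ?_
  · refine (sq_integral_mul_le (memLp_of_continuous hw) (memLp_of_continuous hcf)).trans ?_
    have h2 : ∫ z, f z ^ 2 ∂μ ≤ 1 / a * ∫ z, f z ^ 2 ∂P := by
      rw [one_div, inv_mul_eq_div, le_div_iff₀ ha, mul_comm]
      exact hP _ hcf
    exact mul_le_mul hA h2 (integral_nonneg fun z => sq_nonneg _) (by linarith)
  · have h3 : (inner ℝ v f) ^ 2 ≤ ‖v‖ ^ 2 * ‖f‖ ^ 2 := by
      rw [← mul_pow, ← sq_abs (inner ℝ v f)]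
      exact pow_le_pow_left₀ (abs_nonneg _) (abs_real_inner_le_norm v f) 2
    have h4 : ‖v‖ ^ 2 ≤ 4 * (c * l) * A := hvn.trans (by gcongr)
    calc _ ≤ _ := h3
      _ ≤ 4 * (c * l) * A * ‖f‖ ^ 2 := mul_le_mul_of_nonneg_right h4 (sq_nonneg _)
      _ = _ := by ring

end DegreesOfFreedom

section Cube

/-- The representer of point evaluation, transported from `[-1,1]` to `[0,1]`. -/
theorem exists_representer_unitInterval (m : ℕ) {t : ℝ} (ht : t ∈ Icc (0 : ℝ) 1) :
    ∃ w : ℝ[X], (∀ j ≤ m, ∫ s in Icc (0 : ℝ) 1, w.eval s * s ^ j = t ^ j) ∧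
      ∫ s in Icc (0 : ℝ) 1, w.eval s ^ 2 ≤ 2 * ((m : ℝ) + 1) ^ 2 := by
  obtain ⟨v, hv, hv2⟩ := exists_representer m (t := 2 * t - 1)
    ⟨by linarith [ht.1], by linarith [ht.2]⟩
  have hsub : ∀ p : ℝ[X], ∫ s in Icc (0 : ℝ) 1, p.eval (2 * s - 1) = integralPoly p / 2 := by
    intro p
    rw [integral_Icc_eq_integral_Ioc, ← intervalIntegral.integral_of_le zero_le_one,
      intervalIntegral.integral_comp_mul_sub (fun s => p.eval s) two_ne_zero, integralPoly_apply]
    norm_num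
    ring
  have hw : ∀ s, (C 2 * v.comp (C 2 * X - 1)).eval s = 2 * v.eval (2 * s - 1) := fun s => by simp
  refine ⟨C 2 * v.comp (C 2 * X - 1), fun j hj => ?_, ?_⟩
  · have h := hsub (C 2 * (v * (C (1 / 2) * (X + 1)) ^ j))
    have hd : ((C (1 / 2 : ℝ) * (X + 1)) ^ j).natDegree ≤ m := by
      refine natDegree_pow_le.trans ?_
      have h1 : (C (1 / 2 : ℝ) * (X + 1)).natDegree ≤ 1 :=
        (natDegree_C_mul_le _ _).trans ((natDegree_add_le _ _).trans (by simp))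
      nlinarith
    rw [← smul_eq_C_mul, map_smul, hv _ hd] at h
    refine (integral_congr_ae (Filter.Eventually.of_forall fun s => ?_)).trans (h.trans ?_)
    · simp only [hw, eval_smul, eval_mul, eval_pow, eval_C, eval_add, eval_X, eval_one, smul_eq_mul]
      rw [show 1 / 2 * (2 * s - 1 + 1) = s by ring]
      ring
    · simp only [eval_mul, eval_pow, eval_C, eval_add, eval_X, eval_one, smul_eq_mul]
      rw [show 1 / 2 * (2 * t - 1 + 1) = t by ring]
      ring
  · have h := hsub (C 4 * (v * v))
    rw [← smul_eq_C_mul, map_smul, smul_eq_mul] at h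
    have e : ∫ s in Icc (0 : ℝ) 1, (C 2 * v.comp (C 2 * X - 1)).eval s ^ 2 =
        4 * integralPoly (v * v) / 2 := by
      refine (integral_congr_ae (Filter.Eventually.of_forall fun s => ?_)).trans h
      simp only [hw, eval_smul, eval_mul, smul_eq_mul]
      ring
    rw [e]
    linarith

variable {d : ℕ}

/-- Lebesgue measure on the cube `[0,1]^d`. -/
noncomputable abbrev cubeMeasure (d : ℕ) : Measure (unitCube d) := Measure.comap Subtype.val volume

theorem unitCube_eq_preimage (d : ℕ) :
    unitCube d = WithLp.ofLp ⁻¹' (univ.pi fun _ : Fin d => Icc (0 : ℝ) 1) := by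
  ext x
  simp only [unitCube, mem_ofPred_eq, mem_preimage, mem_univ_pi]

theorem measurableSet_unitCube (d : ℕ) : MeasurableSet (unitCube d) :=
  (isCompact_iff_compactSpace.mpr inferInstance).isClosed.measurableSet

instance cubeMeasure_isProbabilityMeasure (d : ℕ) : IsProbabilityMeasure (cubeMeasure d) := by
  refine ⟨?_⟩
  rw [comap_subtype_coe_apply (measurableSet_unitCube d), image_univ, Subtype.range_coe,
    unitCube_eq_preimage, (PiLp.volume_preserving_ofLp (Fin d)).measure_preimage
      (MeasurableSet.univ_pi fun _ => measurableSet_Icc).nullMeasurableSet, volume_pi_pi]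
  simp

theorem integral_cube_prod (g : Fin d → ℝ → ℝ) :
    ∫ z : unitCube d, ∏ i, g i (z.1 i) ∂cubeMeasure d = ∏ i, ∫ s in Icc (0 : ℝ) 1, g i s := by
  rw [integral_subtype_comap (measurableSet_unitCube d)
    (fun z : EuclideanSpace ℝ (Fin d) => ∏ i, g i (z i)), unitCube_eq_preimage]
  have h := (PiLp.volume_preserving_ofLp (Fin d)).setIntegral_preimage_emb
    (MeasurableEquiv.toLp 2 (Fin d → ℝ)).symm.measurableEmbedding
    (fun y : Fin d → ℝ => ∏ i, g i (y i)) (univ.pi fun _ : Fin d => Icc (0 : ℝ) 1)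
  refine h.trans ?_
  rw [volume_pi, Measure.restrict_pi_pi, integral_fintype_prod_eq_prod]

/-- Point evaluation at `x ∈ [0,1]^d` on polynomials of total degree at most `m` is integration
against a tensor product of one-dimensional representers. -/
theorem exists_cube_representer (m : ℕ) (x : unitCube d) :
    ∃ w : unitCube d → ℝ, Continuous w ∧
      (∀ p : MvPolynomial (Fin d) ℝ, p.totalDegree ≤ m →
        ∫ z, w z * p.eval z.1.ofLp ∂cubeMeasure d = p.eval x.1.ofLp) ∧
      ∫ z, w z ^ 2 ∂cubeMeasure d ≤ (2 * ((m : ℝ) + 1) ^ 2) ^ d := by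
  choose v hv hv2 using fun i => exists_representer_unitInterval m (x.2 i)
  have hcont : Continuous fun z : unitCube d => ∏ i, (v i).eval (z.1 i) :=
    continuous_finsetProd _ fun i _ => (v i).continuous.comp (by fun_prop)
  refine ⟨fun z => ∏ i, (v i).eval (z.1 i), hcont, fun p hp => ?_, ?_⟩
  · simp_rw [MvPolynomial.eval_eq', Finset.mul_sum]
    rw [integral_finsetSum]
    · refine Finset.sum_congr rfl fun u hu => ?_
      have hu' : ∀ i, u i ≤ m := fun i => by
        refine le_trans ?_ ((MvPolynomial.le_totalDegree hu).trans hp)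
        rcases eq_or_ne (u i) 0 with h | h
        · omega
        · exact Finset.single_le_sum (f := fun i => u i) (fun _ _ => Nat.zero_le _)
            (Finsupp.mem_support_iff.2 h)
      have e := integral_cube_prod fun i s => (v i).eval s * s ^ u i
      simp_rw [fun i => hv i (u i) (hu' i), Finset.prod_mul_distrib] at e
      rw [← e, ← integral_const_mul]
      exact integral_congr_ae (Filter.Eventually.of_forall fun z => by ring)
    · intro u _
      refine (memLp_of_continuous hcont).integrable_mul (memLp_of_continuous ?_)
      fun_prop
  · simp_rw [← Finset.prod_pow]
    rw [integral_cube_prod fun i s => (v i).eval s ^ 2]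
    refine (Finset.prod_le_prod (fun i _ => integral_nonneg fun s => sq_nonneg _)
      fun i _ => hv2 i).trans_eq ?_
    simp

theorem exists_mvPolynomial_radial {n : ℕ} {q : ℝ[X]} (hq : q.natDegree ≤ n)
    (z : EuclideanSpace ℝ (Fin d)) :
    ∃ p : MvPolynomial (Fin d) ℝ, p.totalDegree ≤ 2 * n ∧
      ∀ y : EuclideanSpace ℝ (Fin d), p.eval y.ofLp = q.eval ((d : ℝ)⁻¹ * ‖z - y‖ ^ 2) := by
  set r : MvPolynomial (Fin d) ℝ := MvPolynomial.C (d : ℝ)⁻¹ *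
    ∑ i, (MvPolynomial.X i - MvPolynomial.C (z i)) ^ 2 with hr
  have hrd : r.totalDegree ≤ 2 := by
    refine (MvPolynomial.totalDegree_mul _ _).trans ?_
    rw [MvPolynomial.totalDegree_C, zero_add]
    refine MvPolynomial.totalDegree_finsetSum_le fun i _ => ?_
    refine (MvPolynomial.totalDegree_pow _ _).trans ?_
    have := MvPolynomial.totalDegree_sub_C_le (MvPolynomial.X i : MvPolynomial (Fin d) ℝ) (z i)
    rw [MvPolynomial.totalDegree_X] at this
    omega
  refine ⟨∑ j ∈ Finset.range (q.natDegree + 1), q.coeff j • r ^ j, ?_, fun y => ?_⟩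
  · refine MvPolynomial.totalDegree_finsetSum_le fun j hj => ?_
    refine (MvPolynomial.totalDegree_smul_le _ _).trans
      ((MvPolynomial.totalDegree_pow _ _).trans ?_)
    have := Finset.mem_range.1 hj
    nlinarith
  · have hry : r.eval y.ofLp = (d : ℝ)⁻¹ * ‖z - y‖ ^ 2 := by
      rw [hr, EuclideanSpace.norm_sq_eq]
      simp only [map_mul, MvPolynomial.eval_C, map_sum, map_pow, map_sub, MvPolynomial.eval_X,
        PiLp.sub_apply, Real.norm_eq_abs, sq_abs]
      congr 1
      exact Finset.sum_congr rfl fun i _ => by ring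
    rw [eval_eq_sum_range, map_sum]
    refine Finset.sum_congr rfl fun j _ => ?_
    rw [MvPolynomial.smul_eval, map_pow, hry]

theorem radial_arg_mem (x y : unitCube d) :
    (d : ℝ)⁻¹ * ‖(x : EuclideanSpace ℝ (Fin d)) - y‖ ^ 2 ∈ Icc (0 : ℝ) 1 := by
  refine ⟨by positivity, ?_⟩
  have h : ‖(x : EuclideanSpace ℝ (Fin d)) - y‖ ^ 2 ≤ d := by
    rw [EuclideanSpace.norm_sq_eq]
    refine (Finset.sum_le_card_nsmul _ _ 1 fun i _ => ?_).trans (by simp)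
    have h1 := x.2 i
    have h2 := y.2 i
    simp only [PiLp.sub_apply, Real.norm_eq_abs, sq_abs]
    nlinarith [h1.1, h1.2, h2.1, h2.2]
  rw [inv_mul_eq_div]
  exact div_le_one_of_le₀ h (by positivity)

theorem mul_integral_cube_le {p : unitCube d → ℝ} {a : ℝ} (ha : 0 ≤ a)
    (hap : ∀ z, a ≤ p z) [IsFiniteMeasure (designMeasure p)] {f : unitCube d → ℝ}
    (hf : Continuous f) :
    a * ∫ z, f z ^ 2 ∂cubeMeasure d ≤ ∫ z, f z ^ 2 ∂designMeasure p := by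
  have hle : ENNReal.ofReal a • cubeMeasure d ≤ designMeasure p := by
    rw [← withDensity_const]
    exact withDensity_mono (Filter.Eventually.of_forall fun z => ENNReal.ofReal_le_ofReal (hap z))
  have h := integral_mono_measure hle (Filter.Eventually.of_forall fun z => sq_nonneg (f z))
    (memLp_of_continuous hf).integrable_sq
  rwa [integral_smul_measure, ENNReal.toReal_ofReal ha, smul_eq_mul] at h

/-- A polynomial of degree `n` approximating `ψ(t) = φ((t + 1) / 2)` on `[-1,1]` within `c l` bounds
`N_∞(l)` by a constant times `n^{2d}`. -/
theorem maxMarginalDof_le (p : unitCube d → ℝ) {a : ℝ} (ha : 0 < a)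
    (hap : ∀ z, a ≤ p z) [IsFiniteMeasure (designMeasure p)]
    (φ : ℝ → ℝ) (hφ : ContinuousOn φ (Icc 0 1)) [Fact (Matrix.of (radialKernel d φ)).PosSemidef]
    {n : ℕ} {q : ℝ[X]} (hq : q.natDegree ≤ n) {ε : ℝ}
    (hε : ∀ t ∈ Icc (-1 : ℝ) 1, |transplant φ t - q.eval t| ≤ ε) {l c : ℝ} (hl : 0 < l)
    (hεl : ε ≤ c * l) :
    maxMarginalDof (continuous_radialKernel d hφ) (designMeasure p) l ≤
      ((2 * (2 * (2 * (n : ℝ) + 1) ^ 2) ^ d * (1 / a + 4 * c) : ℝ) : EReal) := by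
  refine iSup_le fun x => EReal.coe_le_coe_iff.2 ?_
  obtain ⟨w, hw, hrep, hw2⟩ := exists_cube_representer (2 * n) x
  push_cast at hw2
  set q' : ℝ[X] := q.comp (C 2 * X - 1) with hq'
  have hq'd : q'.natDegree ≤ n := by
    have h1 : (C 2 * X - 1 : ℝ[X]).natDegree ≤ 1 :=
      (natDegree_sub_le _ _).trans
        (max_le ((natDegree_C_mul_le _ _).trans natDegree_X_le) (by simp))
    refine natDegree_comp_le.trans ?_
    nlinarith
  have hq'e : ∀ u ∈ Icc (0 : ℝ) 1, |φ u - q'.eval u| ≤ ε := by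
    intro u hu
    have h := hε (2 * u - 1) ⟨by linarith [hu.1], by linarith [hu.2]⟩
    rw [transplant, show (2 * u - 1 + 1) / 2 = u by ring] at h
    simpa [hq'] using h
  refine inner_pointEval_inverse_le (continuous_radialKernel d hφ) (designMeasure p)
    (cubeMeasure d) ha (fun f hf => mul_integral_cube_le ha.le hap hf) x hw
    (one_le_pow₀ (by nlinarith [(n.cast_nonneg : (0 : ℝ) ≤ n)])) hw2
    (k₀ := fun z y => q'.eval ((d : ℝ)⁻¹ * ‖(z : EuclideanSpace ℝ (Fin d)) - y‖ ^ 2))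
    (fun z => q'.continuous.comp (by fun_prop)) (fun z y => hq'e _ (radial_arg_mem z y))
    (fun z => ?_) hl hεl
  obtain ⟨r, hr, hre⟩ := exists_mvPolynomial_radial hq'd (z : EuclideanSpace ℝ (Fin d))
  simp_rw [← hre]
  exact hrep r hr

end Cube

/-! ### Smooth and analytic profiles -/

section Smoothness

theorem integral_sq_le_of_bound {f : ℝ → ℝ} {b : ℝ} (hf : MemLp f 2 lebI)
    (h : ∀ t ∈ Icc (-1 : ℝ) 1, |f t| ≤ b) : ∫ t, f t ^ 2 ∂lebI ≤ (2 * b) ^ 2 := by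
  have hc : ∫ _, b ^ 2 ∂lebI = 2 * b ^ 2 := by
    rw [← intervalIntegral_eq_lebI, intervalIntegral.integral_const, smul_eq_mul]
    ring
  have hle : ∫ t, f t ^ 2 ∂lebI ≤ ∫ _, b ^ 2 ∂lebI :=
    setIntegral_mono_on hf.integrable_sq (integrable_const _) measurableSet_Icc fun t ht =>
      sq_le_sq' (abs_le.1 (h t ht)).1 (abs_le.1 (h t ht)).2
  nlinarith

theorem exists_poly_of_finiteSmoothness {s : ℕ} {ψ : ℝ → ℝ} (h : FiniteSmoothness (s + 1) ψ) :
    ∃ M : ℝ, 0 ≤ M ∧ ∀ m : ℕ, ∃ q : ℝ[X], q.natDegree ≤ m + s + 1 ∧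
      ∀ t ∈ Icc (-1 : ℝ) 1, |ψ t - q.eval t| ≤ M / (m + 1) ^ s := by
  obtain ⟨g, h0, hg, hbv, -⟩ := h
  have hg' : ∀ j < s + 1, HasAEDeriv (g j) (g (j + 1)) := hg
  set b := |g (s + 1) (-1)| + (eVariationOn (g (s + 1)) (Icc (-1) 1)).toReal with hb
  have hbound : ∀ t ∈ Icc (-1 : ℝ) 1, |g (s + 1) t| ≤ b := by
    intro t ht
    have h1 := hbv.dist_le ht (left_mem_Icc.2 (by norm_num : (-1 : ℝ) ≤ 1))
    rw [Real.dist_eq] at h1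
    have h2 := abs_add_le (g (s + 1) t - g (s + 1) (-1)) (g (s + 1) (-1))
    rw [sub_add_cancel] at h2
    linarith
  have hb0 : 0 ≤ b := by positivity
  have hae : ∀ᵐ t ∂lebI, ‖g (s + 1) t‖ ≤ b :=
    (ae_restrict_iff' measurableSet_Icc).2 (Filter.Eventually.of_forall hbound)
  have hmem : MemLp (g (s + 1)) 2 lebI :=
    MemLp.of_bound (hg' s s.lt_succ_self).aestronglyMeasurable b hae
  have hB : ∫ t, g (s + 1) t ^ 2 ∂lebI ≤ (2 * b) ^ 2 := integral_sq_le_of_bound hmem hbound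
  refine ⟨2 * (2 * b), by positivity, fun m => ?_⟩
  obtain ⟨q, hq, hqe⟩ := exists_poly_near s m g hg' hmem (by positivity) hB
  refine ⟨q, hq, fun t ht => ?_⟩
  rw [← h0 t ht, mul_div_assoc]
  exact hqe t ht

theorem isOpen_bernsteinRegion (ρ : ℝ) : IsOpen (bernsteinRegion ρ) :=
  isOpen_lt (by fun_prop) continuous_const

theorem ofReal_mem_bernsteinRegion {ρ : ℝ} (hρ : 1 < ρ) {t : ℝ} (ht : t ∈ Icc (-1 : ℝ) 1) :
    (t : ℂ) ∈ bernsteinRegion ρ := by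
  have h1 : ‖(t : ℂ) - 1‖ = 1 - t := by
    rw [← Complex.ofReal_one, ← Complex.ofReal_sub, Complex.norm_real, Real.norm_eq_abs,
      abs_of_nonpos (by linarith [ht.2])]
    ring
  have h2 : ‖(t : ℂ) + 1‖ = t + 1 := by
    rw [← Complex.ofReal_one, ← Complex.ofReal_add, Complex.norm_real, Real.norm_eq_abs,
      abs_of_nonneg (by linarith [ht.1])]
  have h3 : ρ * ρ⁻¹ = 1 := mul_inv_cancel₀ (by positivity)
  have h4 : ρ⁻¹ < 1 := inv_lt_one_of_one_lt₀ hρ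
  change ‖(t : ℂ) - 1‖ + ‖(t : ℂ) + 1‖ < ρ + ρ⁻¹
  rw [h1, h2]
  nlinarith

/-- A function analytic around `[-1,1]` is the start of an infinite chain of derivatives obeying
Cauchy's estimates. -/
theorem exists_chain_of_analyticInEllipse {ρ : ℝ} (hρ : 1 < ρ) {ψ : ℝ → ℝ}
    (h : AnalyticInEllipse ρ ψ) :
    ∃ (g : ℕ → ℝ → ℝ) (δ M : ℝ), 0 < δ ∧ 0 ≤ M ∧ (∀ t ∈ Icc (-1 : ℝ) 1, g 0 t = ψ t) ∧
      (∀ j, HasAEDeriv (g j) (g (j + 1))) ∧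
      ∀ j, ∀ t ∈ Icc (-1 : ℝ) 1, |g j t| ≤ j.factorial * M / δ ^ j := by
  obtain ⟨F, hF, hFψ⟩ := h
  set S : Set ℂ := (fun t : ℝ => (t : ℂ)) '' Icc (-1) 1 with hS
  have hSc : IsCompact S := isCompact_Icc.image Complex.continuous_ofReal
  have hSU : S ⊆ bernsteinRegion ρ := by
    rintro _ ⟨t, ht, rfl⟩
    exact ofReal_mem_bernsteinRegion hρ ht
  obtain ⟨δ, hδ, hδU⟩ := hSc.exists_cthickening_subset_open (isOpen_bernsteinRegion ρ) hSU
  obtain ⟨M, hM⟩ := hSc.cthickening.exists_bound_of_continuousOn (hF.continuousOn.mono hδU)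
  have hball : ∀ t ∈ Icc (-1 : ℝ) 1, Metric.closedBall (t : ℂ) δ ⊆ Metric.cthickening δ S :=
    fun t ht => Metric.closedBall_subset_cthickening (mem_image_of_mem _ ht) δ
  have hM0 : 0 ≤ M :=
    (norm_nonneg _).trans (hM _ (hball 0 (by simp) (Metric.mem_closedBall_self hδ.le)))
  have hbound : ∀ j, ∀ t ∈ Icc (-1 : ℝ) 1,
      |(iteratedDeriv j F (t : ℂ)).re| ≤ j.factorial * M / δ ^ j := by
    intro j t ht
    refine (Complex.abs_re_le_norm _).trans ?_
    refine Complex.norm_iteratedDeriv_le_of_forall_mem_sphere_norm_le j hδ ?_ fun z hz =>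
      hM z (hball t ht (Metric.sphere_subset_closedBall hz))
    exact (hF.differentiableOn.mono hδU).diffContOnCl_ball (hball t ht)
  have hderiv : ∀ j, ∀ t ∈ Icc (-1 : ℝ) 1,
      HasDerivAt (fun t : ℝ => (iteratedDeriv j F (t : ℂ)).re)
        (iteratedDeriv (j + 1) F (t : ℂ)).re t := by
    intro j t ht
    have han : AnalyticAt ℂ (iteratedDeriv j F) (t : ℂ) := by
      rw [iteratedDeriv_eq_iterate]
      exact (hF _ (hSU (mem_image_of_mem _ ht))).iterated_deriv j
    rw [iteratedDeriv_succ]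
    exact han.differentiableAt.hasDerivAt.real_of_complex
  refine ⟨fun j t => (iteratedDeriv j F (t : ℂ)).re, δ, M, hδ, hM0, fun t ht => ?_,
    fun j => ⟨?_, ?_⟩, hbound⟩
  · simp [hFψ t ht]
  · refine LipschitzOnWith.absolutelyContinuousOnInterval
      (K := Real.toNNReal ((j + 1).factorial * M / δ ^ (j + 1))) ?_
    rw [uIcc_of_le (by norm_num)]
    refine (convex_Icc (-1 : ℝ) 1).lipschitzOnWith_of_nnnorm_hasDerivWithin_le
      (fun t ht => (hderiv j t ht).hasDerivWithinAt) fun t ht => ?_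
    rw [← NNReal.coe_le_coe, Real.coe_toNNReal _ (by positivity), coe_nnnorm]
    exact hbound (j + 1) t ht
  · exact (ae_restrict_iff' measurableSet_Icc).2 (Filter.Eventually.of_forall (hderiv j))

/-- Exponentially good approximation. Applying the bound for `r` derivatives with degree `N r` for
a large constant `N`, the factor `r! / δ^r` in Cauchy's estimate is beaten by `(N r)^r`. -/
theorem exists_poly_of_analyticInEllipse {ρ : ℝ} (hρ : 1 < ρ) {ψ : ℝ → ℝ}
    (h : AnalyticInEllipse ρ ψ) :
    ∃ (M : ℝ) (N : ℕ), 0 ≤ M ∧ ∀ r : ℕ, 1 ≤ r → ∃ q : ℝ[X], q.natDegree ≤ N * r ∧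
      ∀ t ∈ Icc (-1 : ℝ) 1, |ψ t - q.eval t| ≤ M * Real.exp (-r) := by
  obtain ⟨g, δ, M, hδ, hM, h0, hg, hbound⟩ := exists_chain_of_analyticInEllipse hρ h
  obtain ⟨N, hN⟩ := exists_nat_ge (2 * Real.exp 1 / δ)
  rw [div_le_iff₀ hδ] at hN
  refine ⟨4 * M * (N + 1), N + 1, by positivity, fun r hr => ?_⟩
  obtain ⟨s, rfl⟩ : ∃ s, r = s + 1 := ⟨r - 1, by omega⟩
  set r := s + 1 with hrs
  have hmem : MemLp (g (s + 1)) 2 lebI := memLp_of_continuousOn (hg (s + 1)).continuousOn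
  have hB := integral_sq_le_of_bound (b := r.factorial * M / δ ^ r) hmem (hbound (s + 1))
  obtain ⟨q, hq, hqe⟩ := exists_poly_near s (N * r) g (fun j _ => hg j) hmem (by positivity) hB
  refine ⟨q, hq.trans (by rw [hrs]; ring_nf; omega), fun t ht => ?_⟩
  rw [← h0 t ht]
  refine (hqe t ht).trans ?_
  have hr0 : (1 : ℝ) ≤ r := by exact_mod_cast hr
  have he := Real.exp_pos 1
  have hm : (0 : ℝ) < ((N * r : ℕ) : ℝ) + 1 := by positivity
  have hm1 : ((N * r : ℕ) : ℝ) + 1 ≤ (N + 1) * r := by push_cast; linarith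
  have hfac : (r.factorial : ℝ) ≤ r ^ r := by exact_mod_cast Nat.factorial_le_pow r
  have h2r : (r : ℝ) ≤ 2 ^ r := by exact_mod_cast Nat.lt_two_pow_self.le
  -- By the choice of `N`, the base `δ (N r + 1)` exceeds `2 e r`: the `eʳ` is the gain, and the
  -- `2ʳ` absorbs the linear factor lost because only `r - 1` powers are available.
  have hkey : (2 * Real.exp 1 * r) ^ r ≤ (δ * (((N * r : ℕ) : ℝ) + 1)) ^ r := by
    refine pow_le_pow_left₀ (by positivity) ?_ r
    push_cast
    nlinarith
  have hexp : Real.exp (-(r : ℝ)) = (Real.exp 1 ^ r)⁻¹ := by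
    rw [Real.exp_neg, ← Real.exp_nat_mul, mul_one]
  rw [mul_pow, mul_pow, mul_pow] at hkey
  have hpos : 0 < Real.exp 1 ^ r := by positivity
  have hmr : 0 < (((N * r : ℕ) : ℝ) + 1) ^ s := by positivity
  have hδr : 0 < δ ^ r := by positivity
  have hms : (((N * r : ℕ) : ℝ) + 1) ^ r
      = (((N * r : ℕ) : ℝ) + 1) ^ s * (((N * r : ℕ) : ℝ) + 1) := pow_succ _ _
  set m : ℝ := ((N * r : ℕ) : ℝ) + 1 with hmdef
  have hfin : (r.factorial : ℝ) * Real.exp 1 ^ r ≤ (N + 1) * (δ ^ r * m ^ s) := by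
    have h1 : (2 : ℝ) ^ r * (r.factorial * Real.exp 1 ^ r) ≤ δ ^ r * m ^ r := by
      refine le_trans ?_ hkey
      nlinarith [mul_le_mul_of_nonneg_left hfac (by positivity : 0 ≤ (2 : ℝ) ^ r * Real.exp 1 ^ r)]
    have h2 : δ ^ r * m ^ r ≤ 2 ^ r * ((N + 1) * (δ ^ r * m ^ s)) := by
      rw [hms]
      have h3 : m ≤ (N + 1) * 2 ^ r := hm1.trans (by gcongr)
      nlinarith [mul_le_mul_of_nonneg_left h3 (by positivity : 0 ≤ δ ^ r * m ^ s)]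
    exact le_of_mul_le_mul_left (h1.trans h2) (by positivity)
  rw [hexp, ← div_eq_mul_inv, le_div_iff₀ hpos]
  have e : 2 * (2 * (r.factorial * M / δ ^ r) / m ^ s) * Real.exp 1 ^ r
      = 4 * M * ((r.factorial * Real.exp 1 ^ r) / (δ ^ r * m ^ s)) := by
    field_simp
    ring
  rw [e]
  refine mul_le_mul_of_nonneg_left ?_ (by positivity)
  rwa [div_le_iff₀ (by positivity)]

end Smoothness

theorem maxMarginalDof_le_mul_pow {d : ℕ} (p : unitCube d → ℝ) {a : ℝ} (ha : 0 < a)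
    (hap : ∀ z, a ≤ p z) [IsFiniteMeasure (designMeasure p)]
    (φ : ℝ → ℝ) (hφ : ContinuousOn φ (Icc 0 1)) [Fact (Matrix.of (radialKernel d φ)).PosSemidef]
    {n : ℕ} {q : ℝ[X]} (hq : q.natDegree ≤ n) {ε : ℝ}
    (hε : ∀ t ∈ Icc (-1 : ℝ) 1, |transplant φ t - q.eval t| ≤ ε) {l c b T : ℝ} (hl : 0 < l)
    (hc : 0 ≤ c) (hεl : ε ≤ c * l) (hn : 2 * (n : ℝ) + 1 ≤ b * T) :
    maxMarginalDof (continuous_radialKernel d hφ) (designMeasure p) l ≤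
      ((2 * (2 * b ^ 2) ^ d * (1 / a + 4 * c) * T ^ (2 * d) : ℝ) : EReal) := by
  refine (maxMarginalDof_le p ha hap φ hφ hq hε hl hεl).trans (EReal.coe_le_coe_iff.2 ?_)
  have h : (2 * (2 * (n : ℝ) + 1) ^ 2) ^ d ≤ (2 * (b * T) ^ 2) ^ d := by gcongr
  have e : 2 * (2 * b ^ 2) ^ d * (1 / a + 4 * c) * T ^ (2 * d)
      = 2 * (2 * (b * T) ^ 2) ^ d * (1 / a + 4 * c) := by
    rw [pow_mul, mul_pow b T, ← mul_assoc 2 (b ^ 2), mul_pow _ (T ^ 2)]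
    ring
  rw [e]
  gcongr

theorem theorem1 (d : ℕ) (hd : 1 ≤ d)
    (p : unitCube d → ℝ) (hp : Measurable p) (pmin pmax : ℝ)
    (hpmin : IsGLB (Set.range p) pmin) (hpos : 0 < pmin) (hpmax : IsLUB (Set.range p) pmax)
    [IsProbabilityMeasure (designMeasure p)]
    (φ : ℝ → ℝ) (hφ : ContinuousOn φ (Set.Icc 0 1))
    [Fact (Matrix.of (radialKernel d φ)).PosSemidef] :
    (∀ s : ℕ, 3 * d < s → FiniteSmoothness s (transplant φ) →
      ∃ C l₀ : ℝ, 0 < C ∧ 0 < l₀ ∧ ∀ l : ℝ, 0 < l → l < l₀ →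
        maxMarginalDof (continuous_radialKernel d hφ) (designMeasure p) l ≤
          ((C * l ^ (-(2 * (d : ℝ) / ((s : ℝ) - d - 1 / 2))) : ℝ) : EReal)) ∧
    ((∃ ρ : ℝ, 1 < ρ ∧ AnalyticInEllipse ρ (transplant φ)) →
      ∃ C l₀ : ℝ, 0 < C ∧ 0 < l₀ ∧ ∀ l : ℝ, 0 < l → l < l₀ →
        maxMarginalDof (continuous_radialKernel d hφ) (designMeasure p) l ≤
          ((C * Real.log l⁻¹ ^ (2 * d) : ℝ) : EReal)) := by
  have hap : ∀ z, pmin ≤ p z := fun z => hpmin.1 (mem_range_self z)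
  have hd1 : (1 : ℝ) ≤ d := by exact_mod_cast hd
  constructor
  · intro r hr hsm
    obtain ⟨s, rfl⟩ : ∃ s, r = s + 1 := ⟨r - 1, by omega⟩
    obtain ⟨M, hM, hq⟩ := exists_poly_of_finiteSmoothness hsm
    have hr' : 3 * (d : ℝ) < s + 1 := by exact_mod_cast hr
    set a : ℝ := ((s + 1 : ℕ) : ℝ) - d - 1 / 2 with ha
    push_cast at ha
    have ha0 : 0 < a := by linarith
    have has : a ≤ s := by linarith
    refine ⟨2 * (2 * (2 * (s : ℝ) + 5) ^ 2) ^ d * (1 / pmin + 4 * M), 1, by positivity, one_pos,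
      fun l hl hl1 => ?_⟩
    -- The degree is chosen of order `T = l^(-1/a)`, so that `T^(-s) ≤ T^(-a) = l`.
    set T : ℝ := l ^ (-(1 / a)) with hT
    have hT1 : 1 ≤ T := Real.one_le_rpow_of_pos_of_le_one_of_nonpos hl hl1.le (by simp [ha0.le])
    set m := ⌊T⌋₊ with hm
    have hmT : (m : ℝ) ≤ T := Nat.floor_le (by linarith)
    have hTm : T ≤ m + 1 := (Nat.lt_floor_add_one T).le
    obtain ⟨q, hqd, hqe⟩ := hq m
    have hTs : l⁻¹ ≤ ((m : ℝ) + 1) ^ s := by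
      have h1 : T ^ a = l⁻¹ := by
        rw [hT, ← Real.rpow_mul hl.le, show -(1 / a) * a = -1 by field_simp, Real.rpow_neg_one]
      rw [← h1]
      calc T ^ a ≤ T ^ (s : ℝ) := Real.rpow_le_rpow_of_exponent_le hT1 has
        _ = T ^ s := Real.rpow_natCast T s
        _ ≤ _ := by gcongr
    have hεl : M / ((m : ℝ) + 1) ^ s ≤ M * l := by
      rw [div_eq_mul_inv]
      refine mul_le_mul_of_nonneg_left ?_ hM
      rw [← inv_inv l]
      exact inv_anti₀ (by positivity) hTs
    have hn : 2 * ((m + s + 1 : ℕ) : ℝ) + 1 ≤ (2 * s + 5) * T := by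
      push_cast
      nlinarith [(s.cast_nonneg : (0 : ℝ) ≤ s)]
    have h := maxMarginalDof_le_mul_pow p hpos hap φ hφ hqd hqe hl hM hεl hn
    have e : T ^ (2 * d) = l ^ (-(2 * (d : ℝ) / a)) := by
      rw [← Real.rpow_natCast, hT, ← Real.rpow_mul hl.le]
      congr 1
      push_cast
      field_simp
    rwa [e] at h
  · rintro ⟨ρ, hρ, han⟩
    obtain ⟨M, N, hM, hq⟩ := exists_poly_of_analyticInEllipse hρ han
    refine ⟨2 * (2 * (4 * (N : ℝ) + 1) ^ 2) ^ d * (1 / pmin + 4 * M), Real.exp (-1), by positivity,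
      Real.exp_pos _, fun l hl hl1 => ?_⟩
    set T := Real.log l⁻¹ with hT
    have hlT : l = Real.exp (-T) := by
      rw [hT, Real.log_inv, neg_neg, Real.exp_log hl]
    have hT1 : 1 < T := by
      rw [hlT, Real.exp_lt_exp] at hl1
      linarith
    set r := ⌈T⌉₊ with hr
    have hTr : T ≤ r := Nat.le_ceil T
    have hrT : (r : ℝ) < T + 1 := Nat.ceil_lt_add_one (by linarith)
    obtain ⟨q, hqd, hqe⟩ := hq r (Nat.one_le_ceil_iff.2 (by linarith))
    have hεl : M * Real.exp (-r) ≤ M * l := by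
      rw [hlT]
      gcongr
    have hn : 2 * ((N * r : ℕ) : ℝ) + 1 ≤ (4 * N + 1) * T := by
      push_cast
      nlinarith [(N.cast_nonneg : (0 : ℝ) ≤ N)]
    exact maxMarginalDof_le_mul_pow p hpos hap φ hφ hqd hqe hl hM hεl hn
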